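/- **Setting.** Terms are built from $+,\times,-,0,1$; the language of ordered rings $\Sigma_{Ao}$ has the unary predicates $\cdot=0$ and $\cdot\ge 0$, and the language of strictly ordered rings has in addition $\cdot>0$. One abbreviates $s=t$ for $s-t=0$, $s\le t$ for $t-s\ge0$, $s<t$ for $t-s>0$, and $x\ne0$ for $x^2>0$. A dynamical theory is given by a set of axioms of the form $\Gamma\vdash\exists \underline y^1\Delta_1\ \mathbf{op}\ \cdots\ \mathbf{op}\ \exists \underline y^m\Delta_m$, with $\Gamma,\Delta_i$ finite lists of atomic formulas. A dynamical proof is a finite computation tree: its root carries the hypotheses; at a node one may rewrite terms as integer polynomials, replace a term by one already proved equal to it, or apply an axiom (with terms substituted for its free variables) whose hypotheses are present, opening one branch for each $i$, in which fresh $\underline y^i$ and the facts $\Delta_i$ are added; the conclusion must be present at every leaf. A *Horn rule* is a rule $\Gamma\vdash\Delta$ with $\Gamma,\Delta$ finite lists of atomic formulas. The theories are as follows. * $\mathcal{A}o$ (ordered rings, language $\Sigma_{Ao}$): $\vdash 0=0$; $x=0,y=0\vdash x+y=0$; $x=0\vdash xy=0$; $\vdash0\ge0$; $x\ge0,y\ge0\vdash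 x+y\ge0$; $\vdash x^2\ge0$; $x\ge0,y\ge0\vdash xy\ge0$; and $\mathbf{Gao}$: $x\ge0,x\le0\vdash x=0$. * $\mathcal{A}onz$ is $\mathcal{A}o$ plus $\mathbf{Aonz}$: $c\ge0,\ x(x^2+c)\ge0\vdash x\ge0$. * $\mathcal{A}to$ is $\mathcal{A}o$ plus $\mathbf{OT}$: $\vdash x\ge0\ \mathbf{op}\ x\le0$; and $\mathcal{A}tonz$ is $\mathcal{A}to$ plus $x^2=0\vdash x=0$. * $\mathcal{A}pro$ (proto-ordered rings, with $\cdot>0$) is $\mathcal{A}o$ without $\mathbf{Gao}$, plus $\vdash1>0$; $x>0\vdash x\ge0$; $x>0,y\ge0\vdash x+y>0$; $x>0,y>0\vdash xy>0$; $0>0\vdash1=0$. * $\mathcal{C}od$ (discrete ordered fields) is $\mathcal{A}pro$ plus $\mathbf{Gao}$; $xy=1\vdash x\ne0$; $x\ne0\vdash\exists y\ xy=1$; $\mathbf{OT}$; $\vdash x=0\ \mathbf{op}\ x\ne0$. * $\mathcal{C}rcd$ (discrete real closed fields) is $\mathcal{C}od$ plus, for each $n\in\mathbb{N}$, with $P(x)=\sum_{k=0}^n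 a_kx^k$, the rule $a<b,\ P(a)P(b)<0\vdash\exists x\,(P(x)=0,\ a<x<b)$. A presentation $(G,R)$ in $\Sigma_{Ao}$ is a set $G$ of generators (new constants) and a set $R$ of relations, i.e. closed atomic formulas of $\Sigma_{Ao}\cup G$ (so the predicate $\cdot>0$ does not occur in them). For a theory $\mathcal{T}$, the dynamic algebraic structure $((G,R),\mathcal{T})$ is $\mathcal{T}$ with the constants $G$ and the axioms $\vdash A$ ($A\in R$) added. It *collapses* when it proves $1=0$. **Theorem (formal Positivstellensatz, 1bis).** Let $(G,R)$ be any presentation in the language of ordered rings. 1. $\mathcal{A}o$, $\mathcal{A}pro$, $\mathcal{A}to$, $\mathcal{C}od$ and $\mathcal{C}rcd$ collapse simultaneously: if one of the structures $((G,R),\mathcal{T})$, with $\mathcal{T}$ among these five theories, collapses, then all of them do. 2. $\mathcal{A}onz$, $\mathcal{A}tonz$, $\mathcal{C}od$ and $\mathcal{C}rcd$ prove the same Horn rules: every Horn rule formulated in $\Sigma_{Ao}\cup G$ that is provable in one of the structures $((G,R),\mathcal{T})$, with $\mathcal{T}$ among these four theories, is provable in all of them. 3. For every $n\in\mathbb{N}$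 and all terms $x,p,q$ of $\Sigma_{Ao}\cup G$ (free variables allowed), $((G,R),\mathcal{A}onz)$ proves the Horn rule $p\ge0,\ q\ge0,\ x^{2n}+p=xq\vdash x\ge0$. -/

import Mathlib

/-! Finitary dynamical theories in the language of (strictly) ordered rings: terms, atomic formulas,
dynamical rules, proofs as computation trees, dynamic algebraic structures, and the theories
`Ao`, `Aonz`, `Ato`, `Atonz`, `Apro`, `Cod`, `Crcd`. -/

namespace Dyn

universe u v

/-- Terms built with the function symbols `+`, `×`, `-`, `0`, `1` from the symbols in `V`
(variables, and constants given by generators). -/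
inductive RTerm (V : Type u) : Type u
  | var : V → RTerm V
  | zero : RTerm V
  | one : RTerm V
  | add : RTerm V → RTerm V → RTerm V
  | mul : RTerm V → RTerm V → RTerm V
  | neg : RTerm V → RTerm V

namespace RTerm

variable {V : Type u} {W : Type v}

instance : Zero (RTerm V) := ⟨zero⟩
instance : One (RTerm V) := ⟨one⟩
instance : Add (RTerm V) := ⟨add⟩
instance : Mul (RTerm V) := ⟨mul⟩
instance : Neg (RTerm V) := ⟨neg⟩
instance : Sub (RTerm V) := ⟨fun s t => s + -t⟩

/-- The term `t ^ n`. -/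
def npow (t : RTerm V) : ℕ → RTerm V
  | 0 => 1
  | n + 1 => npow t n * t

instance : Pow (RTerm V) ℕ := ⟨npow⟩

/-- The sum of a finite list of terms. -/
def sum : List (RTerm V) → RTerm V
  | [] => 0
  | t :: l => t + sum l

/-- Simultaneous substitution of terms for the symbols in `V`. -/
def subst (σ : V → RTerm W) : RTerm V → RTerm W
  | var x => σ x
  | zero => 0
  | one => 1
  | add s t => subst σ s + subst σ t
  | mul s t => subst σ s * subst σ t
  | neg t => -subst σ t

/-- Renaming of the symbols in `V`. -/
def rename (f : V → W) (t : RTerm V) : RTerm W := t.subst fun x => var (f x)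

/-- The normal form of a term: the polynomial with integer coefficients that it denotes. -/
noncomputable def toPoly : RTerm V → MvPolynomial V ℤ
  | var x => MvPolynomial.X x
  | zero => 0
  | one => 1
  | add s t => toPoly s + toPoly t
  | mul s t => toPoly s * toPoly t
  | neg t => -toPoly t

end RTerm

/-- The predicates `· = 0` and `· ≥ 0` of the language of ordered rings. -/
inductive OrdPred : Type
  | isZero
  | nonneg

/-- The predicates `· = 0`, `· ≥ 0` and `· > 0` of the language of strictly ordered rings. -/
inductive StrictPred : Type
  | isZero
  | nonneg
  | pos

/-- A set of (unary) predicate symbols extending that of the language of ordered rings.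
The function symbols are always `+`, `×`, `-`, `0`, `1`. -/
class OrdSig (P : Type) where
  incl : OrdPred → P

instance : OrdSig OrdPred := ⟨id⟩

instance : OrdSig StrictPred := ⟨fun
  | OrdPred.isZero => StrictPred.isZero
  | OrdPred.nonneg => StrictPred.nonneg⟩

/-- Atomic formulas: a predicate applied to a term. -/
structure Atom (P : Type) (V : Type u) : Type u where
  pred : P
  term : RTerm V

namespace Atom

variable {P : Type} {V : Type u} {W : Type v}

def subst (σ : V → RTerm W) (A : Atom P V) : Atom P W := ⟨A.pred, A.term.subst σ⟩

def rename (f : V → W) (A : Atom P V) : Atom P W := ⟨A.pred, A.term.rename f⟩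

/-- An atomic formula of the language of ordered rings, read in a larger signature. -/
def incl [OrdSig P] (A : Atom OrdPred V) : Atom P V := ⟨OrdSig.incl A.pred, A.term⟩

end Atom

section Formulas

variable {P : Type} [OrdSig P] {V : Type u}

/-- The formula `t = 0`. -/
def isZero (t : RTerm V) : Atom P V := ⟨OrdSig.incl OrdPred.isZero, t⟩

/-- The formula `t ≥ 0`. -/
def nonneg (t : RTerm V) : Atom P V := ⟨OrdSig.incl OrdPred.nonneg, t⟩

/-- The formula `t > 0`. -/
def pos (t : RTerm V) : Atom StrictPred V := ⟨StrictPred.pos, t⟩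

/-- `s = t` abbreviates `s - t = 0`. -/
def eq (s t : RTerm V) : Atom P V := isZero (s - t)

/-- `s ≤ t` abbreviates `t - s ≥ 0`. -/
def le (s t : RTerm V) : Atom P V := nonneg (t - s)

/-- `s < t` abbreviates `t - s > 0`. -/
def lt (s t : RTerm V) : Atom StrictPred V := pos (t - s)

/-- `t ≠ 0` abbreviates `t ^ 2 > 0`. -/
def neZero (t : RTerm V) : Atom StrictPred V := pos (t ^ 2)

end Formulas

/-- One alternative `∃ y₁, …, y_ex (facts)` in the conclusion of a dynamical rule; the existential
(dummy) variables are the elements of `Fin ex`. -/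
structure Branch (P : Type) (V : Type u) : Type u where
  ex : ℕ
  facts : List (Atom P (V ⊕ Fin ex))

/-- A dynamical rule `Γ ⊢ ∃ y¹ Δ₁ op … op ∃ yᵐ Δₘ` with free variables `x₀, …, x_{nvars - 1}`. -/
structure Rule (P : Type) : Type where
  nvars : ℕ
  hyps : List (Atom P (Fin nvars))
  branches : List (Branch P (Fin nvars))

/-- A dynamical theory (on a given signature) is given by its axioms. -/
abbrev Theory (P : Type) : Type := Set (Rule P)

/-- An alternative without existential variables. -/
def Branch.plain {P : Type} {V : Type u} (Δ : List (Atom P V)) : Branch P V :=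
  ⟨0, Δ.map (Atom.rename Sum.inl)⟩

/-- The rule `Γ ⊢ A` in `n` free variables. -/
def Rule.horn {P : Type} (n : ℕ) (Γ : List (Atom P (Fin n))) (A : Atom P (Fin n)) : Rule P :=
  ⟨n, Γ, [Branch.plain [A]]⟩

/-- `Derives T H Δ`: there is a dynamical proof (a finite computation tree) in the theory `T` which
starts at the root with the facts in `H` and at every leaf of which all formulas of the list `Δ` are
present. At a node one can
* stop, if all formulas of `Δ` are present (`leaf`);
* rewrite the term of a present fact by the computational machinery of polynomials with integer
  coefficients (`compute`);
* replace a term `s` by a term `t` when `s = t` is present (`replace`);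
* apply an axiom `ρ` of `T`, with arbitrary terms `σ` substituted for its free variables, when its
  hypotheses are present: one branch is opened for each alternative `B` of its conclusion, where
  fresh symbols `Sum.inr j` are introduced for the existential variables of `B` and the facts
  of `B` are added (`step`). -/
inductive Derives {P : Type} [OrdSig P] (T : Theory P) :
    {V : Type u} → Set (Atom P V) → List (Atom P V) → Prop
  | leaf {V : Type u} {H : Set (Atom P V)} {Δ : List (Atom P V)}
      (h : ∀ A ∈ Δ, A ∈ H) : Derives T H Δ
  | compute {V : Type u} {H : Set (Atom P V)} {Δ : List (Atom P V)} (p : P) (s t : RTerm V)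
      (hs : (⟨p, s⟩ : Atom P V) ∈ H) (hst : s.toPoly = t.toPoly)
      (h : Derives T (insert ⟨p, t⟩ H) Δ) : Derives T H Δ
  | replace {V : Type u} {H : Set (Atom P V)} {Δ : List (Atom P V)} (p : P) (s t : RTerm V)
      (hst : eq s t ∈ H) (hs : (⟨p, s⟩ : Atom P V) ∈ H)
      (h : Derives T (insert ⟨p, t⟩ H) Δ) : Derives T H Δ
  | step {V : Type u} {H : Set (Atom P V)} {Δ : List (Atom P V)} (ρ : Rule P) (hρ : ρ ∈ T)
      (σ : Fin ρ.nvars → RTerm V) (hyp : ∀ A ∈ ρ.hyps, A.subst σ ∈ H)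
      (h : ∀ B ∈ ρ.branches, Derives T (V := V ⊕ Fin B.ex)
        (Atom.rename Sum.inl '' H ∪
          {A | ∃ C ∈ B.facts, A = C.subst
            (Sum.elim (fun i => (σ i).rename Sum.inl) (fun j => RTerm.var (Sum.inr j)))})
        (Δ.map (Atom.rename Sum.inl))) : Derives T H Δ

/-- A Horn rule `Γ ⊢ Δ` formulated in the language of ordered rings extended by the constants in `G`;
its free variables are the elements of `Fin nvars`. -/
structure HornRule (G : Type u) : Type u where
  nvars : ℕ
  hyps : List (Atom OrdPred (G ⊕ Fin nvars))
  concl : List (Atom OrdPred (G ⊕ Fin nvars))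

section Structures

variable {P : Type} [OrdSig P] {G : Type u}

/-- The dynamic algebraic structure `((G, R), T)` proves the Horn rule `r`. Here `(G, R)` is a
presentation in the language of ordered rings: `R` is a set of atomic formulas with closed terms
built on the generators in `G`. -/
def Proves (T : Theory P) (R : Set (Atom OrdPred G)) (r : HornRule G) : Prop :=
  Derives T
    ((fun A : Atom OrdPred G => (A.rename Sum.inl).incl) '' R ∪ {A | ∃ C ∈ r.hyps, A = C.incl})
    (r.concl.map Atom.incl)

/-- The dynamic algebraic structure `((G, R), T)` collapses: it proves `1 = 0`. -/
def Collapses (T : Theory P) (R : Set (Atom OrdPred G)) : Prop :=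
  Derives T (Atom.incl '' R) [isZero 1]

end Structures

section Axioms

open RTerm (var)

variable (P : Type) [OrdSig P]

/-- `⊢ 0 = 0` -/
def ga0 : Rule P := .horn 0 [] (isZero 0)

/-- `x = 0, y = 0 ⊢ x + y = 0` -/
def ga1 : Rule P := .horn 2 [isZero (var 0), isZero (var 1)] (isZero (var 0 + var 1))

/-- `x = 0 ⊢ x y = 0` -/
def ac2 : Rule P := .horn 2 [isZero (var 0)] (isZero (var 0 * var 1))

/-- `⊢ 0 ≥ 0` -/
def gao0 : Rule P := .horn 0 [] (nonneg 0)

/-- `x ≥ 0, y ≥ 0 ⊢ x + y ≥ 0` -/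
def gao1 : Rule P := .horn 2 [nonneg (var 0), nonneg (var 1)] (nonneg (var 0 + var 1))

/-- `⊢ x² ≥ 0` -/
def ao1 : Rule P := .horn 1 [] (nonneg (var 0 ^ 2))

/-- `x ≥ 0, y ≥ 0 ⊢ x y ≥ 0` -/
def ao2 : Rule P := .horn 2 [nonneg (var 0), nonneg (var 1)] (nonneg (var 0 * var 1))

/-- `x ≥ 0, x ≤ 0 ⊢ x = 0` -/
def Gao : Rule P := .horn 1 [nonneg (var 0), le (var 0) 0] (isZero (var 0))

/-- `x² = 0 ⊢ x = 0` -/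
def Anz : Rule P := .horn 1 [isZero (var 0 ^ 2)] (isZero (var 0))

/-- `c ≥ 0, x (x² + c) ≥ 0 ⊢ x ≥ 0`, with `x = var 0` and `c = var 1` -/
def AonzRule : Rule P :=
  .horn 2 [nonneg (var 1), nonneg (var 0 * (var 0 ^ 2 + var 1))] (nonneg (var 0))

/-- `⊢ x ≥ 0 op x ≤ 0` -/
def OT : Rule P := ⟨1, [], [.plain [nonneg (var 0)], .plain [le (var 0) 0]]⟩

/-- `⊢ 1 > 0` -/
def aso1 : Rule StrictPred := .horn 0 [] (pos 1)

/-- `x > 0 ⊢ x ≥ 0` -/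
def aso2 : Rule StrictPred := .horn 1 [pos (var 0)] (nonneg (var 0))

/-- `x > 0, y ≥ 0 ⊢ x + y > 0` -/
def aso3 : Rule StrictPred := .horn 2 [pos (var 0), nonneg (var 1)] (pos (var 0 + var 1))

/-- `x > 0, y > 0 ⊢ x y > 0` -/
def aso4 : Rule StrictPred := .horn 2 [pos (var 0), pos (var 1)] (pos (var 0 * var 1))

/-- `0 > 0 ⊢ 1 = 0` -/
def colGt : Rule StrictPred := .horn 0 [pos 0] (isZero 1)

/-- `x y = 1 ⊢ x ≠ 0` -/
def Iv : Rule StrictPred := .horn 2 [eq (var 0 * var 1) 1] (neZero (var 0))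

/-- `x ≠ 0 ⊢ ∃ y  x y = 1` -/
def IV : Rule StrictPred :=
  ⟨1, [neZero (var 0)], [⟨1, [eq (var (.inl 0) * var (.inr 0)) 1]⟩]⟩

/-- `⊢ x = 0 op x ≠ 0` -/
def EDne : Rule StrictPred := ⟨1, [], [.plain [isZero (var 0)], .plain [neZero (var 0)]]⟩

/-- The term `∑_{k ≤ n} a_k t ^ k`. -/
def polyTerm {V : Type u} (n : ℕ) (a : Fin (n + 1) → RTerm V) (t : RTerm V) : RTerm V :=
  RTerm.sum ((List.finRange (n + 1)).map fun k => a k * t ^ (k : ℕ))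

/-- `a < b, p(a) p(b) < 0 ⊢ ∃ x (p(x) = 0, a < x, x < b)` where `p(x) = ∑_{k ≤ n} a_k x ^ k`;
here `a = var 0`, `b = var 1` and `a_k = var (k + 2)`. -/
def RCF (n : ℕ) : Rule StrictPred :=
  ⟨n + 3,
    [lt (var 0) (var 1),
      lt (polyTerm n (fun k => var k.succ.succ) (var 0) *
        polyTerm n (fun k => var k.succ.succ) (var 1)) 0],
    [⟨1,
      [isZero (polyTerm n (fun k => var (.inl k.succ.succ)) (var (.inr 0))),
        lt (var (.inl 0)) (var (.inr 0)), lt (var (.inr 0)) (var (.inl 1))]⟩]⟩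

/-- The axioms of preordered rings (the first three are those of commutative rings). -/
def Apo : Theory P := {ga0 P, ga1 P, ac2 P, gao0 P, gao1 P, ao1 P, ao2 P}

/-- Ordered rings. -/
def Ao : Theory OrdPred := Apo OrdPred ∪ {Gao OrdPred}

/-- Strictly reduced ordered rings. -/
def Aonz : Theory OrdPred := Ao ∪ {AonzRule OrdPred}

/-- Linearly ordered rings. -/
def Ato : Theory OrdPred := Ao ∪ {OT OrdPred}

/-- Reduced linearly ordered rings. -/
def Atonz : Theory OrdPred := Ato ∪ {Anz OrdPred}

/-- Proto-ordered rings. -/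
def Apro : Theory StrictPred := Apo StrictPred ∪ {aso1, aso2, aso3, aso4, colGt}

/-- Discrete ordered fields. -/
def Cod : Theory StrictPred := Apro ∪ {Gao StrictPred, Iv, IV, OT StrictPred, EDne}

/-- Discrete real closed fields. -/
def Crcd : Theory StrictPred := Cod ∪ Set.range RCF

end Axioms

end Dyn

namespace Dyn

universe u

/-! ### Preorderings and homomorphisms to ordered fields -/

/-! All the theories are compared through ordered fields. Soundness (`Derives.sound`): if the facts
at the root hold at a point of an ordered field, then so does the conclusion, provided that the
field may be enlarged when an axiom introduces an element. Only the intermediate value axioms need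
an enlargement; `exists_root_between` supplies it one root at a time, so no real closure is needed.

Completeness: the polynomials `f` for which `f ≥ 0` is derivable in a theory `T'` form a precone
(`isPrecone_entailsNonneg`). By Zorn's lemma, a precone avoiding all `-s ^ (2 * n)` is nonnegative
at some point of an ordered field where `s` does not vanish (`IsPrecone.exists_hom`). If a sound
theory `T` collapses, no point satisfies the facts, so `s = 1` shows that `-1 ≥ 0` is derivable in
`T'`. If `T` proves `x ≥ 0`, adjoining `-x` and taking `s = x` yields an identity `x ^ (2 * n) + p =
x * q` with `p ≥ 0` and `q ≥ 0` derivable in `T'`, and `EntailsNonneg.of_certificate` turns it into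
`x ≥ 0`. The source theory is only required to be sound, so a cycle of implications settles each
equivalence. -/

/-- A subset of a commutative ring which is closed under sums and products and contains the
squares (possibly all of the ring). -/
structure IsPrecone {A : Type*} [CommRing A] (N : Set A) : Prop where
  add : ∀ {a b}, a ∈ N → b ∈ N → a + b ∈ N
  mul : ∀ {a b}, a ∈ N → b ∈ N → a * b ∈ N
  sq : ∀ a, a ^ 2 ∈ N

namespace IsPrecone

variable {A : Type*} [CommRing A] {N : Set A}

lemma zero (h : IsPrecone N) : (0 : A) ∈ N := by simpa using h.sq 0

lemma one (h : IsPrecone N) : (1 : A) ∈ N := by simpa using h.sq 1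

lemma sq_mul (h : IsPrecone N) (a : A) {b : A} (hb : b ∈ N) : a ^ 2 * b ∈ N := h.mul (h.sq a) hb

lemma even_pow (h : IsPrecone N) (a : A) (n : ℕ) : a ^ (2 * n) ∈ N := by
  rw [mul_comm, pow_mul]; exact h.sq _

/-- The precone generated by `N` and an element `x`. -/
def adjoin (N : Set A) (x : A) : Set A := {z | ∃ a ∈ N, ∃ b ∈ N, z = a + x * b}

/-- Degree one in `x` suffices: the term `x ^ 2 * (b * d)` of a product falls back into `N`, which
contains the squares. -/
lemma isPrecone_adjoin (h : IsPrecone N) (x : A) : IsPrecone (adjoin N x) where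
  add := by
    rintro _ _ ⟨a, ha, b, hb, rfl⟩ ⟨c, hc, d, hd, rfl⟩
    exact ⟨a + c, h.add ha hc, b + d, h.add hb hd, by ring⟩
  mul := by
    rintro _ _ ⟨a, ha, b, hb, rfl⟩ ⟨c, hc, d, hd, rfl⟩
    exact ⟨a * c + x ^ 2 * (b * d), h.add (h.mul ha hc) (h.sq_mul x (h.mul hb hd)),
      a * d + b * c, h.add (h.mul ha hd) (h.mul hb hc), by ring⟩
  sq a := ⟨a ^ 2, h.sq a, 0, h.zero, by ring⟩

lemma subset_adjoin (h : IsPrecone N) (x : A) : N ⊆ adjoin N x :=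
  fun a ha => ⟨a, ha, 0, h.zero, by ring⟩

lemma mem_adjoin_self (h : IsPrecone N) (x : A) : x ∈ adjoin N x :=
  ⟨0, h.zero, 1, h.one, by ring⟩

/-- A precone which avoids the elements `-s ^ (2 * n)` is contained in a maximal one. -/
lemma exists_maximal (h : IsPrecone N) (s : A) (hs : ∀ n : ℕ, -s ^ (2 * n) ∉ N) :
    ∃ P : Set A, N ⊆ P ∧ Maximal (fun Q => IsPrecone Q ∧ ∀ n : ℕ, -s ^ (2 * n) ∉ Q) P := by
  refine zorn_subset_nonempty {Q | IsPrecone Q ∧ ∀ n : ℕ, -s ^ (2 * n) ∉ Q} ?_ N ⟨h, hs⟩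
  intro c hc hchain hne
  obtain ⟨Q₀, hQ₀⟩ := hne
  have key : ∀ {a b : A}, a ∈ ⋃₀ c → b ∈ ⋃₀ c → ∃ Q ∈ c, a ∈ Q ∧ b ∈ Q := by
    rintro a b ⟨Q, hQ, ha⟩ ⟨Q', hQ', hb⟩
    rcases hchain.total hQ hQ' with hle | hle
    · exact ⟨Q', hQ', hle ha, hb⟩
    · exact ⟨Q, hQ, ha, hle hb⟩
  refine ⟨⋃₀ c, ⟨⟨?_, ?_, ?_⟩, ?_⟩, fun _ => Set.subset_sUnion_of_mem⟩
  · intro a b ha hb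
    obtain ⟨Q, hQ, ha, hb⟩ := key ha hb
    exact ⟨Q, hQ, (hc hQ).1.add ha hb⟩
  · intro a b ha hb
    obtain ⟨Q, hQ, ha, hb⟩ := key ha hb
    exact ⟨Q, hQ, (hc hQ).1.mul ha hb⟩
  · exact fun a => ⟨Q₀, hQ₀, (hc hQ₀).1.sq a⟩
  · rintro n ⟨Q, hQ, hn⟩
    exact (hc hQ).2 n hn

/-! ### Maximal precones: totality and primality of the support -/

section Maximal

variable {P : Set A} {s : A}
  (hP : Maximal (fun Q => IsPrecone Q ∧ ∀ n : ℕ, -s ^ (2 * n) ∉ Q) P)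

include hP

lemma exists_of_notMem_maximal {x : A} (hx : x ∉ P) :
    ∃ n : ℕ, ∃ a ∈ P, ∃ b ∈ P, -s ^ (2 * n) = a + x * b := by
  by_contra! hcon
  have hle := hP.2 (y := adjoin P x) ⟨hP.1.1.isPrecone_adjoin x,
    fun n ⟨a, ha, b, hb, hab⟩ => hcon n a ha b hb hab⟩ (hP.1.1.subset_adjoin x)
  exact hx (hle (hP.1.1.mem_adjoin_self x))

/-- Otherwise `s ^ (2 * n) + a = -x * b` and `s ^ (2 * m) + c = x * d`. Multiplying the two
identities puts `-s ^ (2 * (n + m))` in `P`. -/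
lemma mem_or_neg_mem_maximal (x : A) : x ∈ P ∨ -x ∈ P := by
  by_contra! hcon
  obtain ⟨n, a, ha, b, hb, hab⟩ := exists_of_notMem_maximal hP hcon.1
  obtain ⟨m, c, hc, d, hd, hcd⟩ := exists_of_notMem_maximal hP hcon.2
  have h := hP.1.1
  refine hP.1.2 (n + m) ?_
  have : -s ^ (2 * (n + m)) =
      s ^ (2 * n) * c + a * s ^ (2 * m) + a * c + x ^ 2 * (b * d) := by
    have e₁ : s ^ (2 * n) = -a - x * b := by linear_combination -hab
    have e₂ : s ^ (2 * m) = -c + x * d := by linear_combination -hcd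
    rw [mul_add, pow_add, e₁, e₂]; ring
  rw [this]
  exact h.add (h.add (h.add (h.mul (h.even_pow s n) hc) (h.mul ha (h.even_pow s m)))
    (h.mul ha hc)) (h.sq_mul x (h.mul hb hd))

lemma support_mul_maximal {x : A} (hx : x ∈ P) (hx' : -x ∈ P) (y : A) : x * y ∈ P := by
  rcases mem_or_neg_mem_maximal hP y with hy | hy
  · exact hP.1.1.mul hx hy
  · simpa using hP.1.1.mul hx' hy

/-- Here `-x ∉ P` reads as `x > 0`. The product of `s ^ (2 * n) + a = x * b` and `s ^ (2 * m) + c =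
y * d` shows that `x * y ≤ 0` would force an excluded element into `P`. -/
lemma support_prime_aux {x y : A} (hx : -x ∉ P) (hy : -y ∉ P) (hxy : -(x * y) ∈ P) : False := by
  have h := hP.1.1
  obtain ⟨n, a, ha, b, hb, hab⟩ := exists_of_notMem_maximal hP hx
  obtain ⟨m, c, hc, d, hd, hcd⟩ := exists_of_notMem_maximal hP hy
  refine hP.1.2 (n + m) ?_
  have : -s ^ (2 * (n + m)) =
      s ^ (2 * n) * c + a * s ^ (2 * m) + a * c + -(x * y) * (b * d) := by
    have e₁ : s ^ (2 * n) = -a + x * b := by linear_combination -hab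
    have e₂ : s ^ (2 * m) = -c + y * d := by linear_combination -hcd
    rw [mul_add, pow_add, e₁, e₂]; ring
  rw [this]
  exact h.add (h.add (h.add (h.mul (h.even_pow s n) hc) (h.mul ha (h.even_pow s m)))
    (h.mul ha hc)) (h.mul hxy (h.mul hb hd))

/-- The support of a maximal precone. -/
def supportMaximal : Ideal A where
  carrier := {x | x ∈ P ∧ -x ∈ P}
  zero_mem' := by simpa using hP.1.1.zero
  add_mem' := by
    rintro a b ⟨ha, ha'⟩ ⟨hb, hb'⟩
    exact ⟨hP.1.1.add ha hb, by rw [neg_add]; exact hP.1.1.add ha' hb'⟩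
  smul_mem' := by
    rintro c x ⟨hx, hx'⟩
    have h₁ := support_mul_maximal hP hx hx' c
    have h₂ := support_mul_maximal hP hx' (by simpa using hx) c
    exact ⟨by rwa [smul_eq_mul, mul_comm], by rwa [smul_eq_mul, mul_comm, ← neg_mul]⟩

lemma mem_supportMaximal {x : A} : x ∈ supportMaximal hP ↔ x ∈ P ∧ -x ∈ P := Iff.rfl

lemma notMem_supportMaximal : s ∉ supportMaximal hP := by
  intro hs
  refine hP.1.2 1 ?_
  have := ((supportMaximal hP).mul_mem_left s hs).2
  simpa [pow_two] using this

lemma isPrime_supportMaximal : (supportMaximal hP).IsPrime := by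
  refine ⟨fun htop => notMem_supportMaximal hP (htop ▸ Submodule.mem_top), ?_⟩
  intro x y hxy
  by_contra! hcon
  obtain ⟨hx, hy⟩ := hcon
  -- Outside the support an element is strictly positive up to sign, and `x * y` and its negative
  -- both lie in `P`, so every sign pattern is covered.
  have split : ∀ {z : A}, z ∉ supportMaximal hP → -z ∉ P ∨ -(-z) ∉ P := by
    intro z hz
    by_contra! hcon
    exact hz ⟨by simpa using hcon.2, hcon.1⟩
  obtain ⟨h₁, h₂⟩ := hxy
  rcases split hx with hx | hx <;> rcases split hy with hy | hy <;>
    exact support_prime_aux hP hx hy (by simpa)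

end Maximal

end IsPrecone

/-- A total cone in a field defines a linear order. -/
lemma exists_linearOrder_of_cone {K : Type*} [Field K] (C : Set K)
    (add : ∀ {x y}, x ∈ C → y ∈ C → x + y ∈ C) (mul : ∀ {x y}, x ∈ C → y ∈ C → x * y ∈ C)
    (total : ∀ x, x ∈ C ∨ -x ∈ C) (antisymm : ∀ {x}, x ∈ C → -x ∈ C → x = 0) :
    ∃ (_ : LinearOrder K), IsStrictOrderedRing K ∧ ∀ x : K, x ∈ C → 0 ≤ x := by
  classical
  have zero : (0 : K) ∈ C := by rcases total 0 with h | h <;> simpa using h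
  have one : (1 : K) ∈ C := by
    rcases total 1 with h | h
    · exact h
    · simpa using mul h h
  let o : LinearOrder K :=
    { le := fun x y => y - x ∈ C
      le_refl := fun x => by simpa using zero
      le_trans := fun x y z h₁ h₂ => by
        have := add h₂ h₁
        rwa [sub_add_sub_cancel] at this
      le_antisymm := fun x y h₁ h₂ => by
        have := antisymm h₁ (by rwa [neg_sub])
        exact (sub_eq_zero.1 this).symm
      le_total := fun x y => by
        rcases total (y - x) with h | h
        · exact Or.inl h
        · exact Or.inr (by rwa [neg_sub] at h)
      toDecidableLE := Classical.decRel _ }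
  have le_def : ∀ {x y : K}, x ≤ y ↔ y - x ∈ C := Iff.rfl
  have : IsOrderedAddMonoid K :=
    ⟨fun a b h c => by rw [le_def] at *; rwa [add_sub_add_right_eq_sub],
     fun a b h c => by rw [le_def] at *; rwa [add_sub_add_left_eq_sub]⟩
  have : ZeroLEOneClass K := ⟨by rw [le_def]; simpa using one⟩
  have : IsOrderedRing K := .of_mul_nonneg fun x y hx hy => by
    rw [le_def] at *
    simpa using mul (by simpa using hx) (by simpa using hy)
  exact ⟨o, IsOrderedRing.toIsStrictOrderedRing K, fun x hx => by rw [le_def]; simpa using hx⟩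

/-- The abstract Positivstellensatz: a precone which avoids the elements `-s ^ (2 * n)` is
nonnegative at a homomorphism to an ordered field at which `s` does not vanish. -/
theorem IsPrecone.exists_hom {A : Type u} [CommRing A] {N : Set A} (h : IsPrecone N) (s : A)
    (hs : ∀ n : ℕ, -s ^ (2 * n) ∉ N) :
    ∃ (K : Type u) (_ : Field K) (_ : LinearOrder K) (_ : IsStrictOrderedRing K) (φ : A →+* K),
      (∀ a ∈ N, 0 ≤ φ a) ∧ φ s ≠ 0 := by
  obtain ⟨P, hNP, hP⟩ := h.exists_maximal s hs
  have hpre := hP.1.1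
  let I := supportMaximal hP
  have : I.IsPrime := isPrime_supportMaximal hP
  let K := FractionRing (A ⧸ I)
  let φ : A →+* K := (algebraMap (A ⧸ I) K).comp (Ideal.Quotient.mk I)
  have hφ : ∀ a, φ a = 0 ↔ a ∈ P ∧ -a ∈ P := fun a => by
    rw [← mem_supportMaximal hP, ← Ideal.Quotient.eq_zero_iff_mem]
    exact IsFractionRing.to_map_eq_zero_iff (R := A ⧸ I) (K := K)
  have hsurj : ∀ z : K, ∃ a b : A, φ b ≠ 0 ∧ z = φ a / φ b := by
    intro z
    obtain ⟨x, y, hy, rfl⟩ := IsFractionRing.div_surjective (A := A ⧸ I) z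
    obtain ⟨a, rfl⟩ := Ideal.Quotient.mk_surjective x
    obtain ⟨b, rfl⟩ := Ideal.Quotient.mk_surjective y
    exact ⟨a, b, IsFractionRing.to_map_ne_zero_of_mem_nonZeroDivisors (R := A ⧸ I) hy, rfl⟩
  -- Since `a * b = (a / b) * b ^ 2`, the fraction `a / b` should be nonnegative exactly when `a * b
  -- ∈ P`.
  suffices ∃ (_ : LinearOrder K), IsStrictOrderedRing K ∧
      ∀ z : K, (∃ a b : A, φ b ≠ 0 ∧ z = φ a / φ b ∧ a * b ∈ P) → 0 ≤ z by
    obtain ⟨o, ho, hC⟩ := this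
    refine ⟨K, inferInstance, o, ho, φ, fun a ha => hC _ ⟨a, 1, by simp, by simp, ?_⟩, ?_⟩
    · simpa using hNP ha
    · rw [Ne, hφ]
      exact notMem_supportMaximal hP
  refine exists_linearOrder_of_cone
    {z : K | ∃ a b : A, φ b ≠ 0 ∧ z = φ a / φ b ∧ a * b ∈ P} ?_ ?_ ?_ ?_
  · rintro _ _ ⟨a, b, hb, rfl, hab⟩ ⟨c, d, hd, rfl, hcd⟩
    refine ⟨a * d + b * c, b * d, by simp [hb, hd], by simp [div_add_div _ _ hb hd], ?_⟩
    have := hpre.add (hpre.sq_mul d hab) (hpre.sq_mul b hcd)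
    convert this using 1; ring
  · rintro _ _ ⟨a, b, hb, rfl, hab⟩ ⟨c, d, hd, rfl, hcd⟩
    refine ⟨a * c, b * d, by simp [hb, hd], by simp [div_mul_div_comm], ?_⟩
    convert hpre.mul hab hcd using 1; ring
  · intro z
    obtain ⟨a, b, hb, rfl⟩ := hsurj z
    rcases mem_or_neg_mem_maximal hP (a * b) with hab | hab
    · exact Or.inl ⟨a, b, hb, rfl, hab⟩
    · exact Or.inr ⟨-a, b, hb, by simp [neg_div], by simpa using hab⟩
  · rintro _ ⟨a, b, hb, rfl, hab⟩ ⟨c, d, hd, he, hcd⟩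
    -- Two elements of `P` whose sum lies in the support lie in the support themselves.
    have e : φ (a * b * d ^ 2 + c * d * b ^ 2) = 0 := by
      rw [neg_eq_iff_add_eq_zero, div_add_div _ _ hb hd, div_eq_zero_iff] at he
      have := he.resolve_right (mul_ne_zero hb hd)
      simp only [map_add, map_mul, map_pow]
      linear_combination φ b * φ d * this
    have e' : φ (a * b * d ^ 2) = 0 := by
      refine (hφ _).2 ⟨hpre.mul hab (hpre.sq d), ?_⟩
      have := hpre.add ((hφ _).1 e).2 (hpre.mul hcd (hpre.sq b))
      simpa using this
    have : φ a = 0 := by simpa [hb, hd] using e'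
    simp [this]

/-! ### Adjoining a root between two points where a polynomial changes sign -/

section IVT

open Polynomial

variable {F : Type u} [Field F] [LinearOrder F]

variable (F) in
/-- Sums of squares of polynomials with nonnegative coefficients. -/
noncomputable def weightedSq : AddSubmonoid F[X] :=
  AddSubmonoid.closure {g | ∃ c : F, 0 ≤ c ∧ ∃ q : F[X], g = C c * q ^ 2}

lemma mem_weightedSq {c : F} (hc : 0 ≤ c) (q : F[X]) : C c * q ^ 2 ∈ weightedSq F :=
  AddSubmonoid.subset_closure ⟨c, hc, q, rfl⟩

/-- Replace each squared polynomial by its remainder modulo `f`; the weights are untouched. -/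
lemma exists_weightedSq_natDegree_le {f : F[X]} (hf : 0 < f.natDegree) {x : F[X]}
    (hx : x ∈ weightedSq F) :
    ∃ y ∈ weightedSq F, y.natDegree ≤ 2 * (f.natDegree - 1) ∧ f ∣ x - y := by
  induction hx using AddSubmonoid.closure_induction with
  | zero => exact ⟨0, zero_mem _, by simp, by simp⟩
  | add u v _ _ hu hv =>
    obtain ⟨y, hy, hy', hy''⟩ := hu
    obtain ⟨z, hz, hz', hz''⟩ := hv
    refine ⟨y + z, add_mem hy hz, natDegree_add_le_of_degree_le hy' hz', ?_⟩
    rw [add_sub_add_comm]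
    exact dvd_add hy'' hz''
  | mem x hx =>
    obtain ⟨c, hc, q, rfl⟩ := hx
    refine ⟨_, mem_weightedSq hc (q % f), ?_, ?_⟩
    · refine (natDegree_C_mul_le _ _).trans (natDegree_pow_le.trans ?_)
      have := natDegree_mod_lt q hf.ne'
      gcongr
      omega
    · have : f ∣ q - q % f := ⟨q / f, by linear_combination -EuclideanDomain.div_add_mod q f⟩
      rw [← mul_sub, sq_sub_sq]
      exact (this.mul_left _).mul_left _

variable [IsStrictOrderedRing F]

lemma mul_mem_weightedSq {x y : F[X]} (hx : x ∈ weightedSq F) (hy : y ∈ weightedSq F) :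
    x * y ∈ weightedSq F := by
  induction hx using AddSubmonoid.closure_induction with
  | zero => simp
  | add u v _ _ hu hv => rw [add_mul]; exact add_mem hu hv
  | mem x hx =>
    obtain ⟨c, hc, q, rfl⟩ := hx
    induction hy using AddSubmonoid.closure_induction with
    | zero => simp
    | add u v _ _ hu hv => rw [mul_add]; exact add_mem hu hv
    | mem y hy =>
      obtain ⟨d, hd, r, rfl⟩ := hy
      have : C c * q ^ 2 * (C d * r ^ 2) = C (c * d) * (q * r) ^ 2 := by rw [C_mul]; ring
      rw [this]
      exact mem_weightedSq (mul_nonneg hc hd) _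

lemma eval_weightedSq_nonneg {x : F[X]} (hx : x ∈ weightedSq F) (a : F) : 0 ≤ x.eval a := by
  induction hx using AddSubmonoid.closure_induction with
  | zero => simp
  | add u v _ _ hu hv => rw [eval_add]; exact add_nonneg hu hv
  | mem x hx =>
    obtain ⟨c, hc, q, rfl⟩ := hx
    simp only [eval_mul, eval_C, eval_pow]
    positivity

/-- A polynomial which changes sign divides no polynomial `1 + σ` with `σ` a weighted sum of
squares. -/
lemma not_dvd_one_add_weightedSq {a b : F} {f : F[X]} (hf : f.eval a * f.eval b < 0) {x : F[X]}
    (hx : x ∈ weightedSq F) : ¬ f ∣ 1 + x := by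
  -- Descent on the degree: after reduction modulo `f`, write `1 + y = f * h` with `deg y ≤ 2 * deg
  -- f - 2`, so `deg h < deg f`. As `1 + y` is positive at `a` and `b`, the cofactor `h` changes
  -- sign as `f` does, and it divides `1 + y`.
  induction hn : f.natDegree using Nat.strong_induction_on generalizing f x with
  | _ n ih =>
  intro hdvd
  have hpos : 0 < f.natDegree := by
    by_contra! h0
    rw [eq_C_of_natDegree_le_zero h0, eval_C, eval_C] at hf
    exact (mul_self_nonneg _).not_gt hf
  obtain ⟨y, hy, hdeg, hxy⟩ := exists_weightedSq_natDegree_le hpos hx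
  obtain ⟨h, hh⟩ : f ∣ 1 + y := by
    have := dvd_sub hdvd hxy
    rwa [show 1 + x - (x - y) = 1 + y by ring] at this
  have heval : ∀ c, 0 < f.eval c * h.eval c := fun c => by
    rw [← eval_mul, ← hh, eval_add, eval_one]
    linarith [eval_weightedSq_nonneg hy c]
  have hh' : h.eval a * h.eval b < 0 := by
    by_contra! hcon
    have h₁ := mul_pos (heval a) (heval b)
    have h₂ := mul_nonneg hcon (neg_nonneg.2 hf.le)
    linarith
  have hf0 : f ≠ 0 := by rintro rfl; simp at hf
  have hh0 : h ≠ 0 := by rintro rfl; simp at hh'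
  have hd : (1 + y).natDegree ≤ 2 * (f.natDegree - 1) :=
    natDegree_add_le_of_degree_le (by simp) hdeg
  rw [hh, natDegree_mul hf0 hh0] at hd
  exact ih h.natDegree (by omega) hh' hy rfl ⟨f, by rw [hh, mul_comm]⟩

/-- A polynomial over an ordered field which changes sign has a root in an ordered extension. -/
lemma exists_root_of_sign_change {a b : F} {f : F[X]} (hf : f.eval a * f.eval b < 0) :
    ∃ (K : Type u) (_ : Field K) (_ : LinearOrder K) (_ : IsStrictOrderedRing K) (ι : F →+* K),
      StrictMono ι ∧ ∃ θ, f.eval₂ ι θ = 0 := by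
  -- The precone contains `f` and `-f`, which makes the image of `X` a root, and the nonnegative
  -- constants, which makes the embedding of `F` monotone.
  have hN : IsPrecone {g : F[X] | ∃ x ∈ weightedSq F, f ∣ g - x} := by
    refine ⟨?_, ?_, fun g => ⟨g ^ 2, ?_, by simp⟩⟩
    · rintro g h ⟨x, hx, hgx⟩ ⟨y, hy, hhy⟩
      refine ⟨x + y, add_mem hx hy, ?_⟩
      rw [add_sub_add_comm]
      exact dvd_add hgx hhy
    · rintro g h ⟨x, hx, hgx⟩ ⟨y, hy, hhy⟩
      refine ⟨x * y, mul_mem_weightedSq hx hy, ?_⟩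
      rw [show g * h - x * y = (g - x) * h + x * (h - y) by ring]
      exact dvd_add (hgx.mul_right _) (hhy.mul_left _)
    · simpa using mem_weightedSq zero_le_one g
  obtain ⟨K, _, _, _, φ, hφ, -⟩ := hN.exists_hom 1 (by
    rintro n ⟨x, hx, hdvd⟩
    refine not_dvd_one_add_weightedSq hf hx ?_
    rw [one_pow, ← dvd_neg] at hdvd
    simpa [add_comm] using hdvd)
  have hmono : Monotone (φ.comp C) := fun c d hcd => by
    have := hφ (C (d - c)) ⟨C (d - c), by simpa using mem_weightedSq (sub_nonneg.2 hcd) 1, by simp⟩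
    simpa using this
  refine ⟨K, inferInstance, inferInstance, inferInstance, φ.comp C,
    hmono.strictMono_of_injective (φ.comp C).injective, φ X, ?_⟩
  have h₁ := hφ f ⟨0, zero_mem _, by simp⟩
  have h₂ := hφ (-f) ⟨0, zero_mem _, by simp⟩
  rw [map_neg, neg_nonneg] at h₂
  rw [← hom_eval₂, eval₂_C_X]
  exact le_antisymm h₂ h₁

/-- A polynomial over an ordered field which changes sign on an interval has a root in that
interval in an ordered extension. -/
theorem exists_root_between {a b : F} (hab : a < b) {f : F[X]} (hf : f.eval a * f.eval b < 0) :
    ∃ (K : Type u) (_ : Field K) (_ : LinearOrder K) (_ : IsStrictOrderedRing K) (ι : F →+* K),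
      StrictMono ι ∧ ∃ θ, f.eval₂ ι θ = 0 ∧ ι a < θ ∧ θ < ι b := by
  induction hn : f.natDegree generalizing F with
  | zero =>
    rw [eq_C_of_natDegree_eq_zero hn, eval_C, eval_C] at hf
    exact absurd hf (mul_self_nonneg _).not_gt
  | succ n ih =>
    obtain ⟨K, _, _, _, ι, hι, θ, hθ⟩ := exists_root_of_sign_change hf
    by_cases hin : ι a < θ ∧ θ < ι b
    · exact ⟨K, _, _, inferInstance, ι, hι, θ, hθ, hin⟩
    -- The root fell outside the interval. Then `X - θ` does not change sign between the endpoints,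
    -- so the quotient `g` does, and the induction continues with `g` over `K`.
    obtain ⟨g, hg⟩ : X - C θ ∣ f.map ι := by rw [dvd_iff_isRoot, IsRoot, eval_map, hθ]
    have heval : ∀ c, ι (f.eval c) = (ι c - θ) * g.eval (ι c) := fun c => by
      rw [← eval_map_apply, hg]; simp
    have hsign : 0 ≤ (ι a - θ) * (ι b - θ) := by
      have := hι hab
      rcases le_or_gt θ (ι a) with h | h
      · exact mul_nonneg (by linarith) (by linarith)
      · have := not_lt.1 fun h' => hin ⟨h, h'⟩
        exact mul_nonneg_of_nonpos_of_nonpos (by linarith) (by linarith)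
    have hg' : g.eval (ι a) * g.eval (ι b) < 0 := by
      by_contra! hcon
      have := hι hf
      rw [map_mul, heval, heval, map_zero] at this
      linarith [mul_nonneg hsign hcon]
    have hdeg : g.natDegree = n := by
      have hg0 : g ≠ 0 := by rintro rfl; simp at hg'
      have := congrArg natDegree hg
      rw [natDegree_map, natDegree_mul (X_sub_C_ne_zero θ) hg0, natDegree_X_sub_C, hn] at this
      omega
    obtain ⟨L, _, _, _, κ, hκ, ξ, hξ, h₁, h₂⟩ := ih (hι hab) hg' hdeg
    refine ⟨L, inferInstance, inferInstance, inferInstance, κ.comp ι, hκ.comp hι, ξ, ?_, h₁, h₂⟩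
    rw [← eval₂_map, hg, eval₂_mul, hξ, mul_zero]

end IVT

/-! ### Substitution -/

namespace RTerm

variable {V W U : Type*}

lemma subst_subst (σ : V → RTerm W) (τ : W → RTerm U) (t : RTerm V) :
    (t.subst σ).subst τ = t.subst fun x => (σ x).subst τ := by
  induction t with
  | var x => rfl
  | zero => rfl
  | one => rfl
  | add s t hs ht => exact congrArg₂ RTerm.add hs ht
  | mul s t hs ht => exact congrArg₂ RTerm.mul hs ht
  | neg t ht => exact congrArg RTerm.neg ht

lemma rename_subst (σ : V → RTerm W) (f : W → U) (t : RTerm V) :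
    (t.subst σ).rename f = t.subst fun x => (σ x).rename f := subst_subst _ _ _

lemma subst_rename (f : V → W) (σ : W → RTerm U) (t : RTerm V) :
    (t.rename f).subst σ = t.subst fun x => σ (f x) := subst_subst _ _ _

lemma rename_rename (f : V → W) (g : W → U) (t : RTerm V) :
    (t.rename f).rename g = t.rename (g ∘ f) := subst_subst _ _ _

lemma rename_id (t : RTerm V) : t.rename id = t := by
  induction t with
  | var x => rfl
  | zero => rfl
  | one => rfl
  | add s t hs ht => exact congrArg₂ RTerm.add hs ht
  | mul s t hs ht => exact congrArg₂ RTerm.mul hs ht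
  | neg t ht => exact congrArg RTerm.neg ht

@[simp] lemma toPoly_var (x : V) : (var x).toPoly = MvPolynomial.X x := rfl
@[simp] lemma toPoly_zero : (0 : RTerm V).toPoly = 0 := rfl
@[simp] lemma toPoly_one : (1 : RTerm V).toPoly = 1 := rfl
@[simp] lemma toPoly_add (s t : RTerm V) : (s + t).toPoly = s.toPoly + t.toPoly := rfl
@[simp] lemma toPoly_mul (s t : RTerm V) : (s * t).toPoly = s.toPoly * t.toPoly := rfl
@[simp] lemma toPoly_neg (t : RTerm V) : (-t).toPoly = -t.toPoly := rfl

@[simp] lemma toPoly_sub (s t : RTerm V) : (s - t).toPoly = s.toPoly - t.toPoly :=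
  (sub_eq_add_neg _ _).symm

@[simp] lemma toPoly_pow (t : RTerm V) (n : ℕ) : (t ^ n).toPoly = t.toPoly ^ n := by
  induction n with
  | zero => exact (pow_zero t.toPoly).symm
  | succ n ih => rw [pow_succ, ← ih]; rfl

lemma toPoly_sum (l : List (RTerm V)) : (RTerm.sum l).toPoly = (l.map toPoly).sum := by
  induction l with
  | nil => rfl
  | cons t l ih => rw [List.map_cons, List.sum_cons, ← ih]; rfl

lemma toPoly_subst (σ : V → RTerm W) (t : RTerm V) :
    (t.subst σ).toPoly = MvPolynomial.bind₁ (fun x => (σ x).toPoly) t.toPoly := by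
  induction t with
  | var x => exact (MvPolynomial.bind₁_X_right (fun x => (σ x).toPoly) x).symm
  | zero => exact (map_zero (MvPolynomial.bind₁ (R := ℤ) _)).symm
  | one => exact (map_one (MvPolynomial.bind₁ (R := ℤ) _)).symm
  | add s t hs ht => exact (congrArg₂ HAdd.hAdd hs ht).trans (map_add (MvPolynomial.bind₁ (R := ℤ) _) _ _).symm
  | mul s t hs ht => exact (congrArg₂ HMul.hMul hs ht).trans (map_mul (MvPolynomial.bind₁ (R := ℤ) _) _ _).symm
  | neg t ht => exact (congrArg Neg.neg ht).trans (map_neg (MvPolynomial.bind₁ (R := ℤ) _) _).symm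

/-- This allows derivable facts to be indexed by polynomials instead of terms. -/
lemma toPoly_surjective : Function.Surjective (toPoly : RTerm V → MvPolynomial V ℤ) := by
  intro f
  induction f using MvPolynomial.induction_on with
  | C a =>
    induction a with
    | zero => exact ⟨0, by simp⟩
    | succ i ih =>
      obtain ⟨t, ht⟩ := ih
      exact ⟨t + 1, by simp [ht]⟩
    | pred i ih =>
      obtain ⟨t, ht⟩ := ih
      exact ⟨t - 1, by simp [ht]⟩
  | add p q hp hq =>
    obtain ⟨s, rfl⟩ := hp
    obtain ⟨t, rfl⟩ := hq
    exact ⟨s + t, rfl⟩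
  | mul_X p x hp =>
    obtain ⟨s, rfl⟩ := hp
    exact ⟨s * var x, rfl⟩

end RTerm

namespace Atom

variable {P : Type} {V W U : Type*}

lemma rename_subst (σ : V → RTerm W) (f : W → U) (A : Atom P V) :
    (A.subst σ).rename f = A.subst fun x => (σ x).rename f :=
  congrArg (Atom.mk A.pred) (RTerm.rename_subst _ _ _)

lemma subst_rename (f : V → W) (σ : W → RTerm U) (A : Atom P V) :
    (A.rename f).subst σ = A.subst fun x => σ (f x) :=
  congrArg (Atom.mk A.pred) (RTerm.subst_rename _ _ _)

lemma rename_rename (f : V → W) (g : W → U) (A : Atom P V) :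
    (A.rename f).rename g = A.rename (g ∘ f) :=
  congrArg (Atom.mk A.pred) (RTerm.rename_rename _ _ _)

lemma rename_id (A : Atom P V) : A.rename id = A :=
  congrArg (Atom.mk A.pred) (RTerm.rename_id _)

end Atom

/-! ### Structural properties of dynamical proofs -/

section Structural

variable {P : Type} [OrdSig P] {T : Theory P}

/-- Renaming and weakening are proved together, because under a branching the symbols change along
with the facts; `f` is then extended by the identity on the fresh symbols. -/
lemma Derives.rename {V W : Type u} {H : Set (Atom P V)} {Δ : List (Atom P V)}
    (h : Derives T H Δ) (f : V → W) {H' : Set (Atom P W)} (hf : ∀ A ∈ H, A.rename f ∈ H') :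
    Derives T H' (Δ.map (Atom.rename f)) := by
  induction h generalizing W with
  | leaf h =>
    refine .leaf fun A hA => ?_
    obtain ⟨B, hB, rfl⟩ := List.mem_map.1 hA
    exact hf B (h B hB)
  | compute p s t hs hst _ ih =>
    refine .compute p (s.rename f) (t.rename f) (hf _ hs) ?_ (ih f ?_)
    · rw [RTerm.rename, RTerm.rename, RTerm.toPoly_subst, RTerm.toPoly_subst, hst]
    · rintro A (rfl | hA)
      · exact Or.inl rfl
      · exact Or.inr (hf A hA)
  | replace p s t hst hs _ ih =>
    refine .replace p (s.rename f) (t.rename f) (hf _ hst) (hf _ hs) (ih f ?_)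
    rintro A (rfl | hA)
    · exact Or.inl rfl
    · exact Or.inr (hf A hA)
  | step ρ hρ σ hyp _ ih =>
    refine .step ρ hρ (fun i => (σ i).rename f) (fun A hA => ?_) fun B hB => ?_
    · rw [← Atom.rename_subst]
      exact hf _ (hyp A hA)
    · have := ih B hB (Sum.map f id) (H' := Atom.rename Sum.inl '' H' ∪
        {A | ∃ C ∈ B.facts, A = C.subst (Sum.elim (fun i => ((σ i).rename f).rename Sum.inl)
          (fun j => RTerm.var (Sum.inr j)))}) ?_
      · simpa only [List.map_map, Function.comp_def, Atom.rename_rename, Sum.map_inl] using this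
      · rintro A (⟨A, hA, rfl⟩ | ⟨C, hC, rfl⟩)
        · refine Or.inl ⟨A.rename f, hf A hA, ?_⟩
          rw [Atom.rename_rename, Atom.rename_rename]
          rfl
        · refine Or.inr ⟨C, hC, ?_⟩
          rw [Atom.rename_subst]
          congr 1
          funext i
          rcases i with i | i
          · simp only [Sum.elim_inl, RTerm.rename_rename]
            rfl
          · rfl

variable {V : Type u} {H H' : Set (Atom P V)} {Δ : List (Atom P V)}

lemma Derives.mono (h : Derives T H Δ) (hH : H ⊆ H') : Derives T H' Δ := by
  have := h.rename id (H' := H') fun A hA => by rw [Atom.rename_id]; exact hH hA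
  rwa [show Atom.rename (P := P) (id : V → V) = id from funext Atom.rename_id, List.map_id] at this

/-- The application of an axiom without existential variables. -/
lemma Derives.plainStep {n : ℕ} {Γ : List (Atom P (Fin n))} {L : List (List (Atom P (Fin n)))}
    (hρ : (⟨n, Γ, L.map Branch.plain⟩ : Rule P) ∈ T) (σ : Fin n → RTerm V)
    (hyp : ∀ C ∈ Γ, C.subst σ ∈ H)
    (h : ∀ l ∈ L, Derives T (H ∪ {A | ∃ C ∈ l, A = C.subst σ}) Δ) : Derives T H Δ := by
  refine .step _ hρ σ hyp fun B hB => ?_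
  obtain ⟨l, hl, rfl⟩ := List.mem_map.1 hB
  refine (h l hl).rename Sum.inl ?_
  rintro A (hA | ⟨C, hC, rfl⟩)
  · exact Or.inl ⟨A, hA, rfl⟩
  · refine Or.inr ⟨C.rename Sum.inl, List.mem_map_of_mem hC, ?_⟩
    rw [Atom.rename_subst, Atom.subst_rename]
    rfl

/-! ### Admissible facts, in continuation form -/

variable (T H) in
/-- The formula `A` can be added to the facts at any node where those of `H` are present. -/
def Entails (A : Atom P V) : Prop :=
  ∀ ⦃H' : Set (Atom P V)⦄ ⦃Δ : List (Atom P V)⦄, H ⊆ H' → Derives T (insert A H') Δ →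
    Derives T H' Δ

namespace Entails

variable {A : Atom P V}

lemma of_mem (h : A ∈ H) : Entails T H A := fun H' Δ hH hd => by
  rwa [Set.insert_eq_of_mem (hH h)] at hd

lemma mono (h : Entails T H A) (hH : H ⊆ H') : Entails T H' A :=
  fun _ _ hH' => h (hH.trans hH')

lemma derives_list {L : List (Atom P V)} (hL : ∀ A ∈ L, Entails T H A)
    (h : Derives T (H ∪ {A | A ∈ L}) Δ) : Derives T H Δ := by
  induction L with
  | nil => simpa using h
  | cons B L ih =>
    refine ih (fun A hA => hL A (List.mem_cons_of_mem _ hA)) ?_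
    refine hL B List.mem_cons_self Set.subset_union_left (h.mono ?_)
    rintro A (hA | hA)
    · exact Or.inr (Or.inl hA)
    · rcases List.mem_cons.1 hA with rfl | hA
      · exact Or.inl rfl
      · exact Or.inr (Or.inr hA)

lemma derives (h : ∀ A ∈ Δ, Entails T H A) : Derives T H Δ :=
  derives_list h (.leaf fun _ hA => Or.inr hA)

lemma cut {B : Atom P V} (hB : Entails T H B) (h : Entails T (insert B H) A) :
    Entails T H A := fun H' _ hH hd =>
  hB hH (h (Set.insert_subset_insert hH) (hd.mono (Set.insert_subset_insert
    (Set.subset_insert B H'))))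

lemma compute {p : P} {s t : RTerm V} (hst : s.toPoly = t.toPoly) (h : Entails T H ⟨p, s⟩) :
    Entails T H ⟨p, t⟩ :=
  h.cut fun _ _ hH hd => .compute p s t (hH (Set.mem_insert _ _)) hst hd

lemma replace {p : P} {s t : RTerm V} (hst : Entails T H (eq s t)) (h : Entails T H ⟨p, s⟩) :
    Entails T H ⟨p, t⟩ :=
  h.cut ((hst.mono (Set.subset_insert _ _)).cut fun _ _ hH hd =>
    .replace p s t (hH (Set.mem_insert _ _)) (hH (Set.mem_insert_of_mem _ (Set.mem_insert _ _))) hd)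

/-- This is reasoning by cases: the formula has to be entailed in each alternative opened by the
axiom. -/
lemma plainStep {n : ℕ} {Γ : List (Atom P (Fin n))} {L : List (Atom P (Fin n))}
    (hρ : (⟨n, Γ, L.map fun C => Branch.plain [C]⟩ : Rule P) ∈ T) (σ : Fin n → RTerm V)
    (hyp : ∀ C ∈ Γ, Entails T H (C.subst σ))
    (h : ∀ C ∈ L, Entails T (insert (C.subst σ) H) A) : Entails T H A := by
  intro H' Δ hH hd
  refine derives_list (L := Γ.map (Atom.subst σ)) (fun B hB => ?_) ?_
  · obtain ⟨C, hC, rfl⟩ := List.mem_map.1 hB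
    exact (hyp C hC).mono hH
  refine Derives.plainStep (L := L.map fun C => [C]) (by simpa [Function.comp_def] using hρ) σ
    (fun C hC => Or.inr (List.mem_map_of_mem hC)) fun l hl => ?_
  obtain ⟨C, hC, rfl⟩ := List.mem_map.1 hl
  refine h C hC ?_ (hd.mono (Set.insert_subset_insert
    (Set.subset_union_left.trans Set.subset_union_left)))
  rintro B (rfl | hB)
  · exact Or.inr ⟨C, by simp, rfl⟩
  · exact Or.inl (Or.inl (hH hB))

end Entails

/-! ### Admissible facts indexed by polynomials -/

variable (T H) in
/-- All formulas `p(t)`, where the term `t` denotes the polynomial `f`, are entailed. -/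
def EntailsPoly (p : P) (f : MvPolynomial V ℤ) : Prop :=
  ∀ t : RTerm V, t.toPoly = f → Entails T H ⟨p, t⟩

namespace EntailsPoly

variable {p : P} {f g : MvPolynomial V ℤ}

lemma of_entails {t : RTerm V} (h : Entails T H ⟨p, t⟩) : EntailsPoly T H p t.toPoly :=
  fun _ ht => h.compute ht.symm

lemma of_insert (t : RTerm V) : EntailsPoly T (insert ⟨p, t⟩ H) p t.toPoly :=
  of_entails (.of_mem (Set.mem_insert _ _))

lemma mono (h : EntailsPoly T H p f) (hH : H ⊆ H') : EntailsPoly T H' p f :=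
  fun t ht => (h t ht).mono hH

lemma replace (h : EntailsPoly T H (OrdSig.incl .isZero) (f - g)) (hf : EntailsPoly T H p f) :
    EntailsPoly T H p g := by
  intro t ht
  obtain ⟨s, rfl⟩ := RTerm.toPoly_surjective f
  exact .replace (h (s - t) (by simp [ht])) (hf s rfl)

lemma plainStep {n : ℕ} {Γ : List (Atom P (Fin n))} {L : List (Atom P (Fin n))}
    (hρ : (⟨n, Γ, L.map fun C => Branch.plain [C]⟩ : Rule P) ∈ T)
    (σ : Fin n → MvPolynomial V ℤ)
    (hyp : ∀ C ∈ Γ, EntailsPoly T H C.pred (MvPolynomial.bind₁ σ C.term.toPoly))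
    (h : ∀ C ∈ L, ∀ H' ⊇ H, EntailsPoly T H' C.pred (MvPolynomial.bind₁ σ C.term.toPoly) →
      EntailsPoly T H' p f) : EntailsPoly T H p f := by
  intro t ht
  choose τ hτ using fun i => RTerm.toPoly_surjective (σ i)
  obtain rfl : (fun i => (τ i).toPoly) = σ := funext hτ
  refine .plainStep hρ τ (fun C hC => hyp C hC _ (RTerm.toPoly_subst _ _)) fun C hC =>
    h C hC _ (Set.subset_insert _ _) ?_ t ht
  rw [← RTerm.toPoly_subst]
  exact of_insert _

lemma horn {n : ℕ} {Γ : List (Atom P (Fin n))} {A : Atom P (Fin n)} (hρ : Rule.horn n Γ A ∈ T)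
    (σ : Fin n → MvPolynomial V ℤ)
    (hyp : ∀ C ∈ Γ, EntailsPoly T H C.pred (MvPolynomial.bind₁ σ C.term.toPoly)) :
    EntailsPoly T H A.pred (MvPolynomial.bind₁ σ A.term.toPoly) :=
  plainStep (L := [A]) hρ σ hyp fun C hC H' _ h => by
    rw [List.mem_singleton] at hC
    rwa [hC] at h

end EntailsPoly

end Structural

/-! ### Theories which contain the axioms of preordered rings -/

section Preordered

variable {P : Type} [OrdSig P] {T : Theory P} {V : Type u} {H : Set (Atom P V)}
  {f g x c p q : MvPolynomial V ℤ}

variable (T H) in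
/-- The formula `f = 0` is entailed. -/
abbrev EntailsZero (f : MvPolynomial V ℤ) : Prop := EntailsPoly T H (OrdSig.incl .isZero) f

variable (T H) in
/-- The formula `f ≥ 0` is entailed. -/
abbrev EntailsNonneg (f : MvPolynomial V ℤ) : Prop := EntailsPoly T H (OrdSig.incl .nonneg) f

namespace EntailsZero

lemma mul_right (hT : Apo P ⊆ T) (hf : EntailsZero T H f) (g : MvPolynomial V ℤ) :
    EntailsZero T H (f * g) := by
  have := EntailsPoly.horn (hT (show ac2 P ∈ Apo P by simp [Apo])) (H := H) ![f, g]
    (by simpa [isZero] using hf)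
  simpa [isZero] using this

lemma mul_left (hT : Apo P ⊆ T) (f : MvPolynomial V ℤ) (hg : EntailsZero T H g) :
    EntailsZero T H (f * g) := by
  rw [mul_comm]
  exact hg.mul_right hT f

lemma neg (hT : Apo P ⊆ T) (hf : EntailsZero T H f) : EntailsZero T H (-f) := by
  simpa using hf.mul_right hT (-1)

lemma of_one (hT : Apo P ⊆ T) (h : EntailsZero T H 1) (f : MvPolynomial V ℤ) :
    EntailsZero T H f := by
  simpa using h.mul_right hT f

/-- The fact `0 ≥ 0` is rewritten along `0 = f`. -/
lemma nonneg (hT : Apo P ⊆ T) (hf : EntailsZero T H f) : EntailsNonneg T H f := by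
  refine EntailsPoly.replace (f := 0) (by simpa using hf.neg hT) ?_
  have := EntailsPoly.horn (hT (show gao0 P ∈ Apo P by simp [Apo])) (H := H) ![] (by simp)
  simpa [Dyn.nonneg] using this

end EntailsZero

lemma isPrecone_entailsNonneg (hT : Apo P ⊆ T) : IsPrecone {f | EntailsNonneg T H f} where
  add := by
    intro f g hf hg
    have := EntailsPoly.horn (hT (show gao1 P ∈ Apo P by simp [Apo])) (H := H) ![f, g]
      (by simpa [nonneg] using ⟨hf, hg⟩)
    simpa [nonneg] using this
  mul := by
    intro f g hf hg
    have := EntailsPoly.horn (hT (show ao2 P ∈ Apo P by simp [Apo])) (H := H) ![f, g]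
      (by simpa [nonneg] using ⟨hf, hg⟩)
    simpa [nonneg] using this
  sq := by
    intro f
    have := EntailsPoly.horn (hT (show ao1 P ∈ Apo P by simp [Apo])) (H := H) ![f] (by simp)
    simpa [nonneg] using this

lemma EntailsZero.antisymm (hG : Gao P ∈ T) (hf : EntailsNonneg T H f)
    (hf' : EntailsNonneg T H (-f)) : EntailsZero T H f := by
  have := EntailsPoly.horn hG (H := H) ![f] (by simpa [Dyn.nonneg, le] using And.intro hf hf')
  simpa [isZero] using this

variable (T) in
/-- The rule `c ≥ 0, x (x² + c) ≥ 0 ⊢ x ≥ 0` is admissible. -/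
def StrictlyReduced : Prop :=
  ∀ ⦃V : Type u⦄ ⦃H : Set (Atom P V)⦄ ⦃x c : MvPolynomial V ℤ⦄, EntailsNonneg T H c →
    EntailsNonneg T H (x * (x ^ 2 + c)) → EntailsNonneg T H x

lemma strictlyReduced_of_mem (h : AonzRule P ∈ T) : StrictlyReduced.{u} T := by
  intro V H x c hc hx
  have := EntailsPoly.horn h (H := H) ![x, c] (by simpa [nonneg] using ⟨hc, hx⟩)
  simpa [nonneg] using this

/-- With `c = 0`, strict reducedness says that `x ^ 3 ≥ 0` implies `x ≥ 0`; iterate. -/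
lemma EntailsNonneg.of_pow_three_pow (hT : Apo P ⊆ T) (hA : StrictlyReduced.{u} T) (k : ℕ)
    (h : EntailsNonneg T H (x ^ 3 ^ k)) : EntailsNonneg T H x := by
  induction k with
  | zero => simpa using h
  | succ k ih =>
    refine ih (hA (isPrecone_entailsNonneg hT).zero ?_)
    convert h using 1
    rw [add_zero, pow_succ 3, pow_mul]
    ring

/-- The simplified Positivstellensatz certificate: `p ≥ 0, q ≥ 0, x ^ (2 * n) + p = x q ⊢ x ≥ 0`. -/
lemma EntailsNonneg.of_certificate (hT : Apo P ⊆ T) (hA : StrictlyReduced.{u} T) (n : ℕ)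
    (hp : EntailsNonneg T H p) (hq : EntailsNonneg T H q)
    (h : EntailsZero T H (x ^ (2 * n) + p - x * q)) : EntailsNonneg T H x := by
  have hN := isPrecone_entailsNonneg (H := H) hT
  -- Put `y = x ^ 3 ^ n` and `3 ^ n = n + d`. The certificate times `y * x ^ (2 * d)` gives `y * (y
  -- ^ 2 + x ^ (2 * d) * p) = x ^ (3 ^ n + 2 * d + 1) * q`. As `3 ^ n` is odd, the last exponent is
  -- even, so the right side is nonnegative; hence `y ≥ 0`, and cube roots lead down to `x`.
  obtain ⟨d, hd⟩ := Nat.exists_eq_add_of_le (Nat.lt_pow_self (n := n) (by norm_num : 1 < 3)).le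
  obtain ⟨k, hk⟩ : Odd (3 ^ n) := Odd.pow (by decide)
  refine of_pow_three_pow hT hA n (hA (c := x ^ (2 * d) * p) (hN.mul (hN.even_pow x d) hp) ?_)
  have : x ^ 3 ^ n * ((x ^ 3 ^ n) ^ 2 + x ^ (2 * d) * p) =
      x ^ (3 ^ n + 2 * d) * (x ^ (2 * n) + p - x * q) + x ^ (2 * (k + 1 + d)) * q := by
    have e₁ : (x ^ 3 ^ n) ^ 2 = x ^ (2 * n) * x ^ (2 * d) := by
      rw [← pow_mul, ← pow_add, hd]; congr 1; ring
    have e₂ : x ^ (2 * (k + 1 + d)) = x ^ 3 ^ n * x ^ (2 * d) * x := by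
      rw [hk, ← pow_add, ← pow_succ]; congr 1; ring
    rw [e₁, e₂, pow_add]; ring
  rw [this]
  exact hN.add ((h.mul_left hT _).nonneg hT) (hN.mul (hN.even_pow x _) hq)

/-- If `x ≤ 0`, then `x * (x ^ 2 + c)` is both nonnegative and nonpositive, hence zero. Multiplying
by `x` gives `x ^ 4 = -x ^ 2 * c ≤ 0`, so `x ^ 4 = 0`, and reducedness applied twice gives `x = 0`.
-/
lemma strictlyReduced_of_total (hT : Apo P ⊆ T) (hG : Gao P ∈ T) (hOT : OT P ∈ T)
    (hnz : ∀ {V : Type u} {H : Set (Atom P V)} {x : MvPolynomial V ℤ}, EntailsZero T H (x ^ 2) →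
      EntailsZero T H x) : StrictlyReduced.{u} T := by
  intro V H x c hc hx
  refine EntailsPoly.plainStep (Γ := []) (L := [nonneg (.var 0), le (.var 0) 0]) hOT ![x]
    (by simp) fun C hC H' hH h => ?_
  rcases List.mem_cons.1 hC with rfl | hC
  · simpa [nonneg] using h
  obtain rfl := List.mem_singleton.1 hC
  replace h : EntailsNonneg T H' (-x) := by simpa [le, nonneg] using h
  have hN := isPrecone_entailsNonneg (H := H') hT
  have hc' := hc.mono hH
  have h₁ : EntailsZero T H' (x * (x ^ 2 + c)) := by
    refine .antisymm hG (hx.mono hH) ?_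
    rw [← neg_mul]
    exact hN.mul h (hN.add (hN.sq x) hc')
  have h₂ : EntailsNonneg T H' (-(x ^ 2) ^ 2) := by
    have := hN.add (hN.sq_mul x hc') (((h₁.mul_right hT x).neg hT).nonneg hT)
    rwa [show x ^ 2 * c + -(x * (x ^ 2 + c) * x) = -(x ^ 2) ^ 2 by ring] at this
  exact (hnz (hnz (.antisymm hG (hN.sq (x ^ 2)) h₂))).nonneg hT

end Preordered

/-! ### Consequences of the axioms for strict inequality -/

section Strict

variable {T : Theory StrictPred} {V : Type u} {H : Set (Atom StrictPred V)}
  {x : MvPolynomial V ℤ}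

lemma Apo_subset_Apro : Apo StrictPred ⊆ Apro := Set.subset_union_left

lemma EntailsZero.one_of_pos_zero (hT : Apro ⊆ T) (h : EntailsPoly T H .pos 0) :
    EntailsZero T H 1 := by
  have := EntailsPoly.horn (hT (show colGt ∈ Apro by simp [Apro])) (H := H) ![]
    (by simpa [pos] using h)
  simpa [isZero] using this

/-- Without `Gao`, the collapse comes from adding `1 > 0` and `-1 ≥ 0` to get `0 > 0`. -/
lemma EntailsZero.one_of_nonneg_neg_one (hT : Apro ⊆ T) (h : EntailsNonneg T H (-1)) :
    EntailsZero T H 1 := by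
  have h₁ := EntailsPoly.horn (hT (show aso1 ∈ Apro by simp [Apro])) (H := H) ![] (by simp)
  replace h₁ : EntailsPoly T H .pos 1 := by simpa [pos] using h₁
  have h₂ := EntailsPoly.horn (hT (show aso3 ∈ Apro by simp [Apro])) (H := H) ![1, -1]
    (by simpa [pos, Dyn.nonneg] using And.intro h₁ h)
  exact .one_of_pos_zero hT (by simpa [pos] using h₂)

/-- In the alternative `x ^ 2 > 0`, replacing `x ^ 2` by `0` yields `0 > 0`, and after a collapse
every element is zero. -/
lemma EntailsZero.of_sq (hT : Cod ⊆ T) (h : EntailsZero T H (x ^ 2)) : EntailsZero T H x := by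
  have hApro : Apro ⊆ T := Set.subset_union_left.trans hT
  refine EntailsPoly.plainStep (Γ := []) (L := [isZero (.var 0), neZero (.var 0)])
    (hT (show EDne ∈ Cod by simp [Cod])) ![x] (by simp) fun C hC H' hH h' => ?_
  rcases List.mem_cons.1 hC with rfl | hC
  · simpa [isZero] using h'
  obtain rfl := List.mem_singleton.1 hC
  replace h' : EntailsPoly T H' .pos (x ^ 2) := by simpa [neZero, pos] using h'
  exact EntailsZero.of_one (Apo_subset_Apro.trans hApro)
    (EntailsZero.one_of_pos_zero hApro (.replace (by simpa using h.mono hH) h')) x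

lemma strictlyReduced_of_Cod_subset (hT : Cod ⊆ T) : StrictlyReduced.{u} T :=
  strictlyReduced_of_total ((Apo_subset_Apro.trans Set.subset_union_left).trans hT)
    (hT (by simp [Cod])) (hT (by simp [Cod])) (.of_sq hT)

end Strict

/-! ### Soundness for ordered fields -/

lemma aeval_comp_ringHom {V K L : Type*} [Field K] [Field L] (κ : K →+* L) (v : V → K) (f : MvPolynomial V ℤ) :
    MvPolynomial.aeval (R := ℤ) (κ ∘ v) f = κ (MvPolynomial.aeval (R := ℤ) v f) := by
  have := congrArg (fun φ => φ f) (MvPolynomial.comp_aeval (R := ℤ) v κ.toIntAlgHom)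
  exact this.symm

/-- The interpretation of a predicate in an ordered field. -/
def StrictPred.Sat {K : Type*} [Zero K] [LE K] [LT K] : StrictPred → K → Prop
  | isZero, x => x = 0
  | nonneg, x => 0 ≤ x
  | pos, x => 0 < x

lemma StrictPred.sat_map {K L : Type*} [Field K] [LinearOrder K] [Field L] [LinearOrder L]
    {κ : K →+* L} (hκ : StrictMono κ) (p : StrictPred) (x : K) : p.Sat (κ x) ↔ p.Sat x := by
  cases p
  · exact map_eq_zero κ
  · rw [Sat, Sat, ← map_zero κ, hκ.le_iff_le]
  · rw [Sat, Sat, ← map_zero κ, hκ.lt_iff_lt]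

/-- The truth of an atomic formula at a point of an ordered field, where the predicate symbols are
interpreted through a map `ι` to those of the language of strictly ordered rings. -/
def Atom.Holds {P : Type} (ι : P → StrictPred) {V : Type*} {K : Type*} [Field K] [LinearOrder K]
    (v : V → K) (A : Atom P V) : Prop :=
  (ι A.pred).Sat (MvPolynomial.aeval (R := ℤ) v A.term.toPoly)

section Sound

variable {P : Type} (ι : P → StrictPred)

namespace Atom

variable {ι} {V W : Type*} {K L : Type*} [Field K] [LinearOrder K] [Field L] [LinearOrder L]

lemma holds_subst {σ : V → RTerm W} {v : W → K} {A : Atom P V} :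
    (A.subst σ).Holds ι v ↔ A.Holds ι fun i => MvPolynomial.aeval (R := ℤ) v (σ i).toPoly := by
  rw [Holds, Holds, subst, RTerm.toPoly_subst, MvPolynomial.aeval_bind₁]

lemma holds_rename {f : V → W} {v : W → K} {A : Atom P V} :
    (A.rename f).Holds ι v ↔ A.Holds ι (v ∘ f) := by
  rw [show A.rename f = A.subst fun x => .var (f x) from rfl, holds_subst]
  simp [Function.comp_def]

lemma holds_comp {κ : K →+* L} (hκ : StrictMono κ) {v : V → K} {A : Atom P V} :
    A.Holds ι (κ ∘ v) ↔ A.Holds ι v := by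
  rw [Holds, Holds, aeval_comp_ringHom, StrictPred.sat_map hκ]

end Atom

/-- A rule is sound if, for every point of an ordered field where its hypotheses hold, one of its
alternatives is realized in an ordered extension field. -/
def Rule.Sound (ρ : Rule P) : Prop :=
  ∀ (K : Type u) [Field K] [LinearOrder K] [IsStrictOrderedRing K] (v : Fin ρ.nvars → K),
    (∀ A ∈ ρ.hyps, A.Holds ι v) → ∃ B ∈ ρ.branches,
      ∃ (L : Type u) (_ : Field L) (_ : LinearOrder L) (_ : IsStrictOrderedRing L) (κ : K →+* L),
        StrictMono κ ∧ ∃ w : Fin B.ex → L, ∀ A ∈ B.facts, A.Holds ι (Sum.elim (κ ∘ v) w)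

variable {ι} in
lemma Rule.sound_of_plain {n : ℕ} {Γ : List (Atom P (Fin n))} {L : List (List (Atom P (Fin n)))}
    (h : ∀ (K : Type u) [Field K] [LinearOrder K] [IsStrictOrderedRing K] (v : Fin n → K),
      (∀ A ∈ Γ, A.Holds ι v) → ∃ l ∈ L, ∀ A ∈ l, A.Holds ι v) :
    Rule.Sound.{u} ι ⟨n, Γ, L.map Branch.plain⟩ := by
  intro K _ _ _ v hv
  obtain ⟨l, hl, hlv⟩ := h K v hv
  refine ⟨_, List.mem_map_of_mem hl, K, _, _, inferInstance, RingHom.id K, strictMono_id,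
    Fin.elim0, fun A hA => ?_⟩
  obtain ⟨C, hC, rfl⟩ := List.mem_map.1 hA
  exact Atom.holds_rename.2 (hlv C hC)

variable {ι} in
lemma Rule.sound_horn {n : ℕ} {Γ : List (Atom P (Fin n))} {A : Atom P (Fin n)}
    (h : ∀ (K : Type u) [Field K] [LinearOrder K] [IsStrictOrderedRing K] (v : Fin n → K),
      (∀ A ∈ Γ, A.Holds ι v) → A.Holds ι v) : Rule.Sound.{u} ι (.horn n Γ A) :=
  Rule.sound_of_plain (L := [[A]]) fun K _ _ _ v hv => ⟨[A], by simp, by simpa using h K v hv⟩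

variable {ι} in
lemma Rule.sound_exists {n : ℕ} {Γ : List (Atom P (Fin n))} {F : List (Atom P (Fin n ⊕ Fin 1))}
    (h : ∀ (K : Type u) [Field K] [LinearOrder K] [IsStrictOrderedRing K] (v : Fin n → K),
      (∀ A ∈ Γ, A.Holds ι v) →
        ∃ (L : Type u) (_ : Field L) (_ : LinearOrder L) (_ : IsStrictOrderedRing L) (κ : K →+* L),
          StrictMono κ ∧ ∃ θ : L, ∀ A ∈ F, A.Holds ι (Sum.elim (κ ∘ v) fun _ => θ)) :
    Rule.Sound.{u} ι ⟨n, Γ, [⟨1, F⟩]⟩ := by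
  intro K _ _ _ v hv
  obtain ⟨L, _, _, _, κ, hκ, θ, hθ⟩ := h K v hv
  exact ⟨_, List.mem_singleton_self _, L, _, _, inferInstance, κ, hκ, fun _ => θ, hθ⟩

variable [OrdSig P]

/-- All axioms are sound and the predicates of the language of ordered rings have their usual
interpretation. -/
structure Theory.Sound (T : Theory P) : Prop where
  incl : ∀ a, ι (OrdSig.incl a) = OrdSig.incl a
  rule : ∀ ρ ∈ T, Rule.Sound.{u} ι ρ

variable {ι}

lemma Theory.Sound.subset {T T' : Theory P} (hT : Theory.Sound.{u} ι T) (h : T' ⊆ T) :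
    Theory.Sound.{u} ι T' := ⟨hT.incl, fun ρ hρ => hT.rule ρ (h hρ)⟩

/-- Induction on the tree with the field allowed to vary: at an axiom, follow an alternative
realized in an extension, then pull the conclusion back, since a strictly monotone embedding
preserves and reflects atomic formulas. -/
theorem Derives.sound {T : Theory P} (hT : Theory.Sound.{u} ι T) {V : Type u}
    {H : Set (Atom P V)} {Δ : List (Atom P V)} (h : Derives T H Δ) {K : Type u} [Field K]
    [LinearOrder K] [IsStrictOrderedRing K] (v : V → K) (hv : ∀ A ∈ H, A.Holds ι v) :
    ∀ A ∈ Δ, A.Holds ι v := by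
  induction h generalizing K with
  | leaf h => exact fun A hA => hv A (h A hA)
  | compute p s t hs hst _ ih =>
    refine ih v (Set.forall_mem_insert.2 ⟨?_, hv⟩)
    have := hv _ hs
    rwa [Atom.Holds, ← hst]
  | replace p s t hst hs _ ih =>
    refine ih v (Set.forall_mem_insert.2 ⟨?_, hv⟩)
    have h₁ := hv _ hst
    have h₂ := hv _ hs
    rw [Atom.Holds, eq, isZero, hT.incl] at h₁
    have h₃ : MvPolynomial.aeval (R := ℤ) v (s - t).toPoly = 0 := h₁
    rw [RTerm.toPoly_sub, map_sub, sub_eq_zero] at h₃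
    rwa [Atom.Holds, ← h₃]
  | step ρ hρ σ hyp _ ih =>
    obtain ⟨B, hB, L, _, _, _, κ, hκ, w, hw⟩ := hT.rule ρ hρ K
      (fun i => MvPolynomial.aeval (R := ℤ) v (σ i).toPoly)
      fun A hA => Atom.holds_subst.1 (hv _ (hyp A hA))
    have := ih B hB (Sum.elim (κ ∘ v) w) ?_
    · intro A hA
      have hA' := this _ (List.mem_map_of_mem hA)
      rwa [Atom.holds_rename, Sum.elim_comp_inl, Atom.holds_comp hκ] at hA'
    · rintro A (⟨A, hA, rfl⟩ | ⟨C, hC, rfl⟩)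
      · rw [Atom.holds_rename, Sum.elim_comp_inl, Atom.holds_comp hκ]
        exact hv A hA
      · rw [Atom.holds_subst]
        convert hw C hC using 1
        funext i
        rcases i with i | i
        · simp only [Sum.elim_inl, RTerm.rename, RTerm.toPoly_subst, MvPolynomial.aeval_bind₁,
            RTerm.toPoly_var, MvPolynomial.aeval_X, Function.comp_apply]
          exact aeval_comp_ringHom κ v _
        · simp

end Sound

lemma aeval_polyTerm {V K : Type*} [Field K] {n : ℕ} (a : Fin (n + 1) → RTerm V) (t : RTerm V) (v : V → K) :
    MvPolynomial.aeval (R := ℤ) v (polyTerm n a t).toPoly =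
      ∑ k, MvPolynomial.aeval (R := ℤ) v (a k).toPoly *
        MvPolynomial.aeval (R := ℤ) v t.toPoly ^ (k : ℕ) := by
  rw [polyTerm, RTerm.toPoly_sum, List.map_map, ← Fin.sum_univ_def, map_sum]
  simp

/-! ### Soundness of the individual theories -/

section SoundTheories

variable {P : Type} [OrdSig P] {ι : P → StrictPred} {V : Type*} {K : Type u} [Field K]
  [LinearOrder K]

lemma holds_isZero (hι : ∀ a, ι (OrdSig.incl a) = OrdSig.incl a) {v : V → K} {t : RTerm V} :
    (isZero t : Atom P V).Holds ι v ↔ MvPolynomial.aeval (R := ℤ) v t.toPoly = 0 := by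
  rw [isZero, Atom.Holds, hι]; rfl

lemma holds_nonneg (hι : ∀ a, ι (OrdSig.incl a) = OrdSig.incl a) {v : V → K} {t : RTerm V} :
    (nonneg t : Atom P V).Holds ι v ↔ 0 ≤ MvPolynomial.aeval (R := ℤ) v t.toPoly := by
  rw [nonneg, Atom.Holds, hι]; rfl

lemma holds_pos {v : V → K} {t : RTerm V} :
    (pos t).Holds id v ↔ 0 < MvPolynomial.aeval (R := ℤ) v t.toPoly := Iff.rfl

lemma Apo_sound (hι : ∀ a, ι (OrdSig.incl a) = OrdSig.incl a) :
    Theory.Sound.{u} ι (Apo P) := by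
  refine ⟨hι, fun ρ hρ => ?_⟩
  rcases hρ with rfl | rfl | rfl | rfl | rfl | rfl | rfl <;>
    refine Rule.sound_horn fun K _ _ _ v hv => ?_ <;>
    simp [holds_isZero hι, holds_nonneg hι] at hv ⊢
  · simp [hv]
  · exact Or.inl hv
  · exact add_nonneg hv.1 hv.2
  · positivity
  · exact mul_nonneg hv.1 hv.2

lemma Theory.Sound.insert {T : Theory P} (hT : Theory.Sound.{u} ι T) {T' : Theory P}
    (h : ∀ ρ ∈ T', Rule.Sound.{u} ι ρ) : Theory.Sound.{u} ι (T ∪ T') :=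
  ⟨hT.incl, fun ρ hρ => hρ.elim (hT.rule ρ) (h ρ)⟩

lemma Gao_sound (hι : ∀ a, ι (OrdSig.incl a) = OrdSig.incl a) :
    Rule.Sound.{u} ι (Gao P) := by
  refine Rule.sound_horn fun K _ _ _ v hv => ?_
  simp [holds_isZero hι, holds_nonneg hι, le] at hv ⊢
  exact le_antisymm hv.2 hv.1

lemma OT_sound (hι : ∀ a, ι (OrdSig.incl a) = OrdSig.incl a) :
    Rule.Sound.{u} ι (OT P) := by
  refine Rule.sound_of_plain (L := [[nonneg (.var 0)], [le (.var 0) 0]]) fun K _ _ _ v _ => ?_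
  simpa [holds_nonneg hι, le] using le_total 0 (v 0)

lemma Ao_sound : Theory.Sound.{u} OrdSig.incl Ao :=
  (Apo_sound fun _ => rfl).insert (by rintro _ rfl; exact Gao_sound fun _ => rfl)

lemma Aonz_sound : Theory.Sound.{u} OrdSig.incl Aonz := by
  refine Ao_sound.insert ?_
  rintro _ rfl
  refine Rule.sound_horn fun K _ _ _ v hv => ?_
  simp [holds_nonneg (ι := OrdSig.incl) fun _ : OrdPred => rfl] at hv ⊢
  by_contra! hneg
  nlinarith [mul_pos_of_neg_of_neg hneg hneg]

lemma Atonz_sound : Theory.Sound.{u} OrdSig.incl Atonz := by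
  refine (Ao_sound.insert ?_).insert ?_
  · rintro _ rfl
    exact OT_sound fun _ => rfl
  · rintro _ rfl
    refine Rule.sound_horn fun K _ _ _ v hv => ?_
    simpa [holds_isZero (ι := OrdSig.incl) fun _ : OrdPred => rfl] using hv

lemma Apro_sound : Theory.Sound.{u} id Apro := by
  refine (Apo_sound fun _ => rfl).insert ?_
  rintro _ (rfl | rfl | rfl | rfl | rfl) <;>
    refine Rule.sound_horn fun K _ _ _ v hv => ?_ <;>
    simp [holds_nonneg (ι := id) fun _ : OrdPred => rfl, holds_pos] at hv ⊢
  · exact hv.le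
  · exact add_pos_of_pos_of_nonneg hv.1 hv.2
  · exact mul_pos hv.1 hv.2

lemma Cod_sound : Theory.Sound.{u} id Cod := by
  refine Apro_sound.insert ?_
  rintro _ (rfl | rfl | rfl | rfl | rfl)
  · exact Gao_sound fun _ => rfl
  · refine Rule.sound_horn fun K _ _ _ v hv => ?_
    simp [holds_isZero (ι := id) fun _ : OrdPred => rfl, eq, neZero, holds_pos] at hv ⊢
    have : v 0 ≠ 0 := by rintro h0; simp [h0] at hv
    positivity
  · refine Rule.sound_exists fun K _ _ _ v hv => ⟨K, _, _, inferInstance, RingHom.id K,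
      strictMono_id, (v 0)⁻¹, ?_⟩
    simp [holds_isZero (ι := id) fun _ : OrdPred => rfl, eq, neZero, holds_pos] at hv ⊢
    have : v 0 ≠ 0 := by rintro h0; simp [h0] at hv
    rw [mul_inv_cancel₀ this, sub_self]
  · exact OT_sound fun _ => rfl
  · refine Rule.sound_of_plain (L := [[isZero (.var 0)], [neZero (.var 0)]])
      fun K _ _ _ v _ => ?_
    simpa [holds_isZero (ι := id) fun _ : OrdPred => rfl, neZero, holds_pos] using
      (em (v 0 = 0)).imp_right fun h => (by positivity : 0 < v 0 ^ 2)

lemma RCF_sound (n : ℕ) : Rule.Sound.{u} id (RCF n) := by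
  refine Rule.sound_exists fun K _ _ _ v hv => ?_
  let f : Polynomial K := ∑ k : Fin (n + 1), Polynomial.C (v k.succ.succ) * Polynomial.X ^ (k : ℕ)
  simp [lt, holds_pos, aeval_polyTerm] at hv
  obtain ⟨hab, hf⟩ := hv
  obtain ⟨L, _, _, _, κ, hκ, θ, hθ, h₁, h₂⟩ := exists_root_between (f := f) hab
    (by simpa [f, Polynomial.eval_finsetSum] using hf)
  refine ⟨L, _, _, inferInstance, κ, hκ, θ, ?_⟩
  simp [lt, holds_isZero (ι := id) fun _ : OrdPred => rfl, holds_pos, aeval_polyTerm, h₁, h₂]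
  simpa [f, Polynomial.eval₂_finsetSum] using hθ

lemma Crcd_sound : Theory.Sound.{u} id Crcd :=
  Cod_sound.insert (by rintro _ ⟨n, rfl⟩; exact RCF_sound n)

end SoundTheories

/-! ### Completeness with respect to ordered fields -/

section Complete

variable {P P' : Type} [OrdSig P] [OrdSig P'] {ι : P → StrictPred} {T : Theory P} {T' : Theory P'}
  {V : Type u} {H : Set (Atom OrdPred V)}

lemma Atom.holds_incl (hι : ∀ a, ι (OrdSig.incl a) = OrdSig.incl a) {K : Type*} [Field K]
    [LinearOrder K] {v : V → K} {A : Atom OrdPred V} :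
    (A.incl : Atom P V).Holds ι v ↔ A.Holds OrdSig.incl v := by
  rw [Atom.Holds, Atom.incl, hι]; rfl

/-- A homomorphism from the polynomial ring is evaluation at a point. The facts of `H` hold there
because `N` contains everything `T'` shows nonnegative; for a fact `t = 0` this covers both `t` and
`-t`. Soundness of `T` then applies at that point. -/
lemma Derives.holds_of_precone (hT : Theory.Sound.{u} ι T) (hT' : Apo P' ⊆ T')
    {Δ : List (Atom OrdPred V)} (h : Derives T (Atom.incl '' H) (Δ.map Atom.incl))
    {N : Set (MvPolynomial V ℤ)} (hN : IsPrecone N)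
    (hle : {f | EntailsNonneg T' (Atom.incl '' H) f} ⊆ N) (s : MvPolynomial V ℤ)
    (hs : ∀ n : ℕ, -s ^ (2 * n) ∉ N) :
    ∃ (K : Type u) (_ : Field K) (_ : LinearOrder K) (_ : IsStrictOrderedRing K) (v : V → K),
      (∀ f ∈ N, 0 ≤ MvPolynomial.aeval (R := ℤ) v f) ∧ MvPolynomial.aeval (R := ℤ) v s ≠ 0 ∧
      ∀ A ∈ Δ, A.Holds OrdSig.incl v := by
  obtain ⟨K, _, _, _, φ, hφ, hφs⟩ := hN.exists_hom s hs
  have hv : ∀ f, MvPolynomial.aeval (R := ℤ) (fun i => φ (.X i)) f = φ f :=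
    MvPolynomial.eval₂Hom_X (algebraMap ℤ K) φ
  refine ⟨K, _, _, inferInstance, fun i => φ (.X i), fun f hf => by rw [hv]; exact hφ f hf,
    by rwa [hv], fun A hA => ?_⟩
  rw [← Atom.holds_incl hT.incl]
  refine h.sound hT _ ?_ _ (List.mem_map_of_mem hA)
  rintro _ ⟨B, hB, rfl⟩
  rw [Atom.holds_incl hT.incl]
  have hE := EntailsPoly.of_entails
    (Entails.of_mem (T := T') (Set.mem_image_of_mem (Atom.incl (P := P')) hB))
  obtain ⟨p, t⟩ := B
  rw [Atom.Holds, hv]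
  cases p
  · replace hE : EntailsZero T' (Atom.incl '' H) t.toPoly := hE
    have h₁ := hφ _ (hle (hE.nonneg hT'))
    have h₂ := hφ _ (hle ((hE.neg hT').nonneg hT'))
    rw [map_neg, neg_nonneg] at h₂
    exact le_antisymm h₂ h₁
  · exact hφ _ (hle hE)

lemma entailsNonneg_neg_one (hT : Theory.Sound.{u} ι T) (hT' : Apo P' ⊆ T')
    (h : Derives T (Atom.incl '' H) [isZero 1]) : EntailsNonneg T' (Atom.incl '' H) (-1) := by
  by_contra hcon
  obtain ⟨K, _, _, _, v, -, -, hv⟩ := Derives.holds_of_precone (Δ := [isZero 1]) hT hT' h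
    (isPrecone_entailsNonneg hT') subset_rfl 1 fun n => by rwa [one_pow]
  have := (holds_isZero fun _ => rfl).1 (hv _ (List.mem_singleton_self _))
  simp at this

lemma collapses_of_collapses (hT : Theory.Sound.{u} ι T) (hT' : Apo P' ⊆ T')
    (hone : ∀ H : Set (Atom P' V), EntailsNonneg T' H (-1) → EntailsZero T' H 1)
    (h : Collapses T H) : Collapses T' H :=
  Entails.derives fun A hA => by
    rw [List.mem_singleton.1 hA]
    exact hone _ (entailsNonneg_neg_one hT hT' h) 1 rfl

/-- Adjoin `-x` to the derivable precone. Either some `-x ^ (2 * n)` appears, which is exactly a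
certificate for `x ≥ 0`, or there is a point with `x < 0` where `Δ` holds, contradicting `hx`. -/
lemma entailsNonneg_of_derives (hT : Theory.Sound.{u} ι T) (hT' : Apo P' ⊆ T')
    (hA : StrictlyReduced.{u} T') {Δ : List (Atom OrdPred V)}
    (h : Derives T (Atom.incl '' H) (Δ.map Atom.incl)) {x : MvPolynomial V ℤ}
    (hx : ∀ (K : Type u) [Field K] [LinearOrder K] [IsStrictOrderedRing K] (v : V → K),
      (∀ A ∈ Δ, A.Holds OrdSig.incl v) → 0 ≤ MvPolynomial.aeval (R := ℤ) v x) :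
    EntailsNonneg T' (Atom.incl '' H) x := by
  by_contra hcon
  have hN := isPrecone_entailsNonneg (H := Atom.incl '' H) hT'
  have hs : ∀ n : ℕ, -x ^ (2 * n) ∉
      IsPrecone.adjoin {f | EntailsNonneg T' (Atom.incl '' H) f} (-x) := by
    rintro n ⟨p, hp, q, hq, hpq⟩
    refine hcon (.of_certificate hT' hA n hp hq ?_)
    rw [show x ^ (2 * n) + p - x * q = (0 : RTerm V).toPoly by
      rw [RTerm.toPoly_zero]; linear_combination -hpq]
    have := EntailsPoly.horn (hT' (show ga0 P' ∈ Apo P' by simp [Apo])) (H := Atom.incl '' H) ![]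
      (by simp)
    simpa [isZero] using this
  obtain ⟨K, _, _, _, v, hv, hv', hΔ⟩ := h.holds_of_precone hT hT' (hN.isPrecone_adjoin (-x))
    (hN.subset_adjoin (-x)) x hs
  have h₁ := hv _ (hN.mem_adjoin_self (-x))
  rw [map_neg, neg_nonneg] at h₁
  exact hv' (le_antisymm h₁ (hx K v hΔ))

lemma derives_of_derives (hT : Theory.Sound.{u} ι T) (hT' : Apo P' ⊆ T') (hG : Gao P' ∈ T')
    (hA : StrictlyReduced.{u} T') {Δ : List (Atom OrdPred V)}
    (h : Derives T (Atom.incl '' H) (Δ.map Atom.incl)) :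
    Derives T' (Atom.incl '' H) (Δ.map Atom.incl) := by
  refine Entails.derives fun A hA' => ?_
  obtain ⟨⟨p, t⟩, hB, rfl⟩ := List.mem_map.1 hA'
  cases p
  · refine EntailsZero.antisymm (f := t.toPoly) hG ?_ ?_ t rfl <;>
      refine entailsNonneg_of_derives hT hT' hA h fun K _ _ _ v hv => ?_ <;>
      have ht : MvPolynomial.aeval (R := ℤ) v t.toPoly = 0 := hv _ hB <;>
      simp [ht]
  · exact entailsNonneg_of_derives hT hT' hA h (fun K _ _ _ v hv => hv _ hB) t rfl

/-- The free variables of a Horn rule act as further generators and its hypotheses as further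
relations. -/
lemma proves_iff_derives {R : Set (Atom OrdPred V)} {r : HornRule V} :
    Proves T R r ↔ Derives T
      (Atom.incl '' ((fun A : Atom OrdPred V => A.rename Sum.inl) '' R ∪ {C | C ∈ r.hyps}))
      (r.concl.map Atom.incl) := by
  rw [Proves, Set.image_union, Set.image_image]
  congr! 3
  ext A
  simp [eq_comm]

lemma proves_of_proves (hT : Theory.Sound.{u} ι T) (hT' : Apo P' ⊆ T') (hG : Gao P' ∈ T')
    (hA : StrictlyReduced.{u} T') {R : Set (Atom OrdPred V)} {r : HornRule V}
    (h : Proves T R r) : Proves T' R r :=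
  proves_iff_derives.2 (derives_of_derives hT hT' hG hA (proves_iff_derives.1 h))

end Complete

/-! ### Inclusions between the theories, and strict reducedness of two of them -/

lemma Ao_subset_Ato : Ao ⊆ Ato := Set.subset_union_left

lemma Ato_subset_Atonz : Ato ⊆ Atonz := Set.subset_union_left

lemma Ao_subset_Aonz : Ao ⊆ Aonz := Set.subset_union_left

lemma Apo_subset_Ao : Apo OrdPred ⊆ Ao := Set.subset_union_left

lemma Gao_mem_Ao : Gao OrdPred ∈ Ao := Or.inr rfl

lemma Apro_subset_Cod : Apro ⊆ Cod := Set.subset_union_left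

lemma Gao_mem_Cod : Gao StrictPred ∈ Cod := by simp [Cod]

lemma Cod_subset_Crcd : Cod ⊆ Crcd := Set.subset_union_left

lemma strictlyReduced_Aonz : StrictlyReduced.{u} Aonz := strictlyReduced_of_mem (Or.inr rfl)

lemma strictlyReduced_Atonz : StrictlyReduced.{u} Atonz := by
  have hAo := Ao_subset_Ato.trans Ato_subset_Atonz
  refine strictlyReduced_of_total (Apo_subset_Ao.trans hAo) (hAo Gao_mem_Ao)
    (Ato_subset_Atonz (Or.inr rfl)) fun {V H x} h => ?_
  have := EntailsPoly.horn (T := Atonz) (H := H) (Or.inr rfl : Anz OrdPred ∈ Atonz) ![x]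
    (by simpa [isZero] using h)
  simpa [isZero] using this

end Dyn

open Dyn in
theorem mainTheorem3 {G : Type*} (R : Set (Dyn.Atom Dyn.OrdPred G)) :
    List.TFAE [Dyn.Collapses Dyn.Ao R, Dyn.Collapses Dyn.Apro R, Dyn.Collapses Dyn.Ato R,
      Dyn.Collapses Dyn.Cod R, Dyn.Collapses Dyn.Crcd R] ∧
    (∀ r : Dyn.HornRule G,
      List.TFAE [Dyn.Proves Dyn.Aonz R r, Dyn.Proves Dyn.Atonz R r,
        Dyn.Proves Dyn.Cod R r, Dyn.Proves Dyn.Crcd R r]) ∧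
    (∀ (m n : ℕ) (x p q : Dyn.RTerm (G ⊕ Fin m)),
      Dyn.Proves Dyn.Aonz R
        ⟨m, [Dyn.nonneg p, Dyn.nonneg q, Dyn.eq (x ^ (2 * n) + p) (x * q)], [Dyn.nonneg x]⟩) := by
  refine ⟨?_, fun r => ?_, fun m n x p q => ?_⟩
  -- In the presence of `Gao`, the square `1 ≥ 0` together with `-1 ≥ 0` gives `1 = 0`.
  · have hord : ∀ {T : Theory OrdPred}, Ao ⊆ T → ∀ H : Set (Atom OrdPred G),
        EntailsNonneg T H (-1) → EntailsZero T H 1 := fun hT H h =>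
      .antisymm (hT Gao_mem_Ao) (isPrecone_entailsNonneg (Apo_subset_Ao.trans hT)).one h
    have hstr : ∀ {T : Theory StrictPred}, Apro ⊆ T → ∀ H : Set (Atom StrictPred G),
        EntailsNonneg T H (-1) → EntailsZero T H 1 := fun hT H h => .one_of_nonneg_neg_one hT h
    have hApro := Apro_subset_Cod.trans Cod_subset_Crcd
    tfae_have 1 → 2 := collapses_of_collapses Ao_sound Apo_subset_Apro (hstr subset_rfl)
    tfae_have 2 → 3 := collapses_of_collapses Apro_sound (Apo_subset_Ao.trans Ao_subset_Ato)
      (hord Ao_subset_Ato)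
    tfae_have 3 → 4 := collapses_of_collapses (Atonz_sound.subset Ato_subset_Atonz)
      (Apo_subset_Apro.trans Apro_subset_Cod) (hstr Apro_subset_Cod)
    tfae_have 4 → 5 := collapses_of_collapses Cod_sound (Apo_subset_Apro.trans hApro) (hstr hApro)
    tfae_have 5 → 1 := collapses_of_collapses Crcd_sound Apo_subset_Ao (hord subset_rfl)
    tfae_finish
  · have hApo := Apo_subset_Apro.trans Apro_subset_Cod
    have hAo := Ao_subset_Ato.trans Ato_subset_Atonz
    tfae_have 1 → 2 := proves_of_proves Aonz_sound (Apo_subset_Ao.trans hAo) (hAo Gao_mem_Ao)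
      strictlyReduced_Atonz
    tfae_have 2 → 3 := proves_of_proves Atonz_sound hApo Gao_mem_Cod
      (strictlyReduced_of_Cod_subset subset_rfl)
    tfae_have 3 → 4 := proves_of_proves Cod_sound (hApo.trans Cod_subset_Crcd)
      (Cod_subset_Crcd Gao_mem_Cod) (strictlyReduced_of_Cod_subset Cod_subset_Crcd)
    tfae_have 4 → 1 := proves_of_proves Crcd_sound (Apo_subset_Ao.trans Ao_subset_Aonz)
      (Ao_subset_Aonz Gao_mem_Ao) strictlyReduced_Aonz
    tfae_finish
  · refine proves_iff_derives.2 (Entails.derives fun A hA => ?_)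
    rw [List.mem_singleton.1 hA]
    have hmem : ∀ A : Atom OrdPred (G ⊕ Fin m), A ∈ [nonneg p, nonneg q,
        Dyn.eq (x ^ (2 * n) + p) (x * q)] → EntailsPoly Aonz (Atom.incl ''
          ((fun A : Atom OrdPred G => A.rename Sum.inl) '' R ∪ {C | C ∈ [nonneg p, nonneg q,
            Dyn.eq (x ^ (2 * n) + p) (x * q)]})) A.pred A.term.toPoly := fun A hA =>
      .of_entails (.of_mem ⟨_, Or.inr hA, rfl⟩)
    refine EntailsNonneg.of_certificate (x := x.toPoly) (p := p.toPoly) (q := q.toPoly)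
      (Apo_subset_Ao.trans Ao_subset_Aonz) strictlyReduced_Aonz n (hmem (nonneg p) (by simp))
      (hmem (nonneg q) (by simp)) ?_ x rfl
    have := hmem (Dyn.eq (x ^ (2 * n) + p) (x * q)) (by simp)
    simpa [Dyn.eq, isZero] using this
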